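/- Let $(W,S)$ be a Coxeter system with $S$ finite, let $\Bbbk$ be an integral domain, and let $\mathfrak h=(V,\{\alpha_s^\vee\}_{s\in S}\subset V,\{\alpha_s\}_{s\in S}\subset V^*)$ be a balanced realization of $(W,S)$ over $\Bbbk$ that satisfies Demazure surjectivity, where $V$ is a free $\Bbbk$-module of finite rank. Let $\mathscr D_{BS}$ be the associated Elias–Williamson diagrammatic category, with objects $B_{\underline w}(n)$ for words $\underline w$ in $S$ and $n\in\mathbb Z$; for a parabolic subsystem of type $H_3$, the three-colour relation equates two composites of braid moves up to a combination of degree-$0$ diagrams that factor through shorter words, and the statement holds for every choice of such a relation. Let $\mathscr D_{BS}^\oplus$ be the additive hull of $\mathscr D_{BS}$. For $r\in R=\mathrm{Sym}(V^*)=\mathrm{End}^\bullet(B_\varnothing)$ and a morphism $f$, write $r\star f$ and $f\star r$ for $f$ with the box $r$ placed to its left and to its right. Let $\Lambda=\bigwedge V^*$, with $V^*$ in bidegree $(1,2)$, and $R^\vee=\mathrm{Sym}(V)$, with $V$ in bidegree $(0,-2)$. A $\mathscr D_{BS}^\oplus$-sequence is a family $\mathcal F=(\mathcal F^p)_{p\in\mathbb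 Z}$ of objects of $\mathscr D_{BS}^\oplus$, almost all of them zero. For two such sequences put $$\underline{\mathrm{Hom}}_{BE}(\mathcal F,\mathcal G)^i_j=\prod_{q-p=i-j}\mathrm{Hom}_{\mathscr D_{BS}^\oplus}(\mathcal F^p,\mathcal G^q(j)),\qquad \underline{\mathrm{Hom}}_{FM}(\mathcal F,\mathcal G)=\Lambda\otimes\underline{\mathrm{Hom}}_{BE}(\mathcal F,\mathcal G)\otimes R^\vee,$$ with the composition $(r\otimes f\otimes x)\circ(s\otimes g\otimes y)=(-1)^{|f||s|}(r\wedge s)\otimes(f\circ g)\otimes xy$, where $|\cdot|$ is the first (cohomological) degree. Define $$\kappa\bigl((r_1\wedge\dots\wedge r_k)\otimes f\otimes x\bigr)=\sum_{i=1}^k(-1)^{i+1}(r_1\wedge\dots\widehat{r_i}\dots\wedge r_k)\otimes(r_i\star f)\otimes x$$ and $\Theta=\sum_i 1\otimes(\mathrm{id}\star e_i)\otimes\check e_i$, where $(e_i)$ and $(\check e_i)$ are dual bases of $V^*$ and $V$. A free-monodromic complex is a pair $(\mathcal F,\delta_{\mathcal F})$ of a $\mathscr D_{BS}^\oplus$-sequence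 $\mathcal F$ and an element $\delta_{\mathcal F}\in\underline{\mathrm{End}}_{FM}(\mathcal F)^1_0$ with $\delta_{\mathcal F}\circ\delta_{\mathcal F}+\kappa(\delta_{\mathcal F})=\Theta$. For free-monodromic complexes $\mathcal F,\mathcal G$, let $\mathrm{gHom}_{FM}(\mathcal F,\mathcal G)$ be the bigraded cohomology of $\underline{\mathrm{Hom}}_{FM}(\mathcal F,\mathcal G)$ with respect to the differential $$d(f)=\kappa(f)+\delta_{\mathcal G}\circ f+(-1)^{|f|+1}f\circ\delta_{\mathcal F},$$ with the induced composition, and put $\mathrm{gEnd}_{FM}(\mathcal F)=\mathrm{gHom}_{FM}(\mathcal F,\mathcal F)$. For $x\in V$ let $x\frown(-)$ be the operator on $\underline{\mathrm{Hom}}_{FM}$ induced by the contraction $$x\frown(r_1\wedge\dots\wedge r_k)=\sum_{i=1}^k(-1)^{i+1}r_i(x)\,r_1\wedge\dots\widehat{r_i}\dots\wedge r_k .$$ Then the following hold for all free-monodromic complexes $\mathcal F,\mathcal G,\mathcal H$. 1. For each $x\in V$ the element $x\frown\delta_{\mathcal F}$ is a cocycle, and there is a unique $\Bbbk$-algebra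 homomorphism $\mu_{\mathcal F}:R^\vee\to\mathrm{gEnd}_{FM}(\mathcal F)$ with $\mu_{\mathcal F}(x)=[x\frown\delta_{\mathcal F}]$ for all $x\in V$. It is bigraded. 2. For $x\in R^\vee$ and $f\in\mathrm{gHom}_{FM}(\mathcal F,\mathcal G)$ one has $\mu_{\mathcal G}(x)\circ f=f\circ\mu_{\mathcal F}(x)$, and $x\,\hat\star\,f:=\mu_{\mathcal G}(x)\circ f$ makes $\mathrm{gHom}_{FM}(\mathcal F,\mathcal G)$ a bigraded left $R^\vee$-module (left monodromy). For $g\in\mathrm{gHom}_{FM}(\mathcal G,\mathcal H)$, $$x\,\hat\star\,(g\circ f)=(x\,\hat\star\,g)\circ f=g\circ(x\,\hat\star\,f).$$ 3. The differential $d$ commutes with the right action $(r\otimes f\otimes x)\cdot y=r\otimes f\otimes xy$ of $R^\vee$ on $\underline{\mathrm{Hom}}_{FM}(\mathcal F,\mathcal G)$. The induced action $f\,\hat\star\,y$ makes $\mathrm{gHom}_{FM}(\mathcal F,\mathcal G)$ a bigraded right $R^\vee$-module (right monodromy), and $$(g\circ f)\,\hat\star\,y=(g\,\hat\star\,y)\circ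 f=g\circ(f\,\hat\star\,y).$$ 4. The two actions commute, $(x\,\hat\star\,f)\,\hat\star\,y=x\,\hat\star\,(f\,\hat\star\,y)$, so $\mathrm{gHom}_{FM}(\mathcal F,\mathcal G)$ is an $R^\vee$-bimodule. -/

import Mathlib

/-! ## Realizations of Coxeter systems -/

/-- The value `[n]_x` at `(x, y)` of the two-coloured quantum numbers; `[n]_y` is `twoColorQ y x n`. -/
def twoColorQ {R : Type*} [CommRing R] (x y : R) : ℕ → R
  | 0 => 0
  | 1 => 1
  | n + 2 => (if Even n then x else y) * twoColorQ x y (n + 1) - twoColorQ x y n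

/-- A realization of the Coxeter system `(W, S)` (with `S` indexed by `B`) over `𝕜`. -/
structure Realization {B W : Type*} [Group W] {M : CoxeterMatrix B} (cs : CoxeterSystem M W)
    (𝕜 V : Type*) [CommRing 𝕜] [AddCommGroup V] [Module 𝕜 V] where
  coroot : B → V
  root : B → Module.Dual 𝕜 V
  root_coroot : ∀ s, root s (coroot s) = 2
  exists_rep : ∃ ρ : Representation 𝕜 W V,
    ∀ s v, ρ (cs.simple s) v = v - root s v • coroot s
  quantum_eq_zero : ∀ s t, s ≠ t → M s t ≠ 0 →
    twoColorQ (-(root t (coroot s))) (-(root s (coroot t))) (M s t) = 0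

/-! ## Cohomology -/

section Cohomology

variable {𝕜 X Y Z : Type*} [CommRing 𝕜] [AddCommGroup X] [Module 𝕜 X] [AddCommGroup Y]
  [Module 𝕜 Y] [AddCommGroup Z] [Module 𝕜 Z]

/-- The total cohomology (cocycles modulo coboundaries) of a differential `d`. -/
def Cohomology (d : X →ₗ[𝕜] X) : Type _ :=
  LinearMap.ker d ⧸ (LinearMap.range d).submoduleOf (LinearMap.ker d)

namespace Cohomology

variable {d : X →ₗ[𝕜] X} {d' : Y →ₗ[𝕜] Y} {d'' : Z →ₗ[𝕜] Z}

instance : AddCommGroup (Cohomology d) :=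
  inferInstanceAs (AddCommGroup (LinearMap.ker d ⧸ _))

instance : Module 𝕜 (Cohomology d) := inferInstanceAs (Module 𝕜 (LinearMap.ker d ⧸ _))

def mkₗ (d : X →ₗ[𝕜] X) : LinearMap.ker d →ₗ[𝕜] Cohomology d := Submodule.mkQ _

/-- The class of a cocycle. -/
def mk (x : X) (hx : d x = 0) : Cohomology d := mkₗ d ⟨x, hx⟩

theorem ind {p : Cohomology d → Prop} (h : ∀ x hx, p (mk x hx)) (z : Cohomology d) : p z := by
  obtain ⟨⟨x, hx⟩, rfl⟩ := Submodule.Quotient.mk_surjective _ z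
  exact h x hx

theorem mk_eq_zero_iff {x : X} {hx : d x = 0} : mk x hx = 0 ↔ ∃ y, d y = x :=
  Submodule.Quotient.mk_eq_zero _

theorem mk_eq_mk_iff {x y : X} {hx : d x = 0} {hy : d y = 0} :
    mk x hx = mk y hy ↔ ∃ z, d z = x - y :=
  Submodule.Quotient.eq _

/-- The classes of the cocycles that belong to a given submodule. -/
def classes (d : X →ₗ[𝕜] X) (N : Submodule 𝕜 X) : Submodule 𝕜 (Cohomology d) :=
  (N.submoduleOf (LinearMap.ker d)).map (mkₗ d)

/-- The bilinear map induced on cohomology by a bilinear map that is compatible with cocycles and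
coboundaries. -/
def map₂ (β : X →ₗ[𝕜] Y →ₗ[𝕜] Z) (h : ∀ x y, d x = 0 → d' y = 0 → d'' (β x y) = 0)
    (hl : ∀ x y, d' y = 0 → ∃ z, d'' z = β (d x) y)
    (hr : ∀ x y, d x = 0 → ∃ z, d'' z = β x (d' y)) :
    Cohomology d →ₗ[𝕜] Cohomology d' →ₗ[𝕜] Cohomology d'' :=
  Submodule.liftQ _
    (LinearMap.flip <| Submodule.liftQ _
      (LinearMap.flip <| LinearMap.mk₂ 𝕜
        (fun (x : LinearMap.ker d) (y : LinearMap.ker d') => mk (β x.1 y.1) (h _ _ x.2 y.2))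
        (fun _ _ _ => by simp only [mk, ← map_add]; congr 1; ext1; simp)
        (fun _ _ _ => by simp only [mk, ← map_smul]; congr 1; ext1; simp)
        (fun _ _ _ => by simp only [mk, ← map_add]; congr 1; ext1; simp)
        (fun _ _ _ => by simp only [mk, ← map_smul]; congr 1; ext1; simp)) <| by
        rintro ⟨_, _⟩ ⟨y, rfl⟩
        ext ⟨x, hx⟩
        exact mk_eq_zero_iff.mpr (hr x y hx))
    (by
      rintro ⟨_, _⟩ ⟨x, rfl⟩
      ext ⟨y, hy⟩
      exact mk_eq_zero_iff.mpr (hl x y hy))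

theorem map₂_mk (β : X →ₗ[𝕜] Y →ₗ[𝕜] Z) (h : ∀ x y, d x = 0 → d' y = 0 → d'' (β x y) = 0)
    (hl : ∀ x y, d' y = 0 → ∃ z, d'' z = β (d x) y)
    (hr : ∀ x y, d x = 0 → ∃ z, d'' z = β x (d' y)) (x : X) (hx : d x = 0) (y : Y)
    (hy : d' y = 0) :
    map₂ β h hl hr (mk x hx) (mk y hy) = mk (β x y) (h x y hx hy) := rfl

end Cohomology

end Cohomology

section EliasWilliamson

variable {B W : Type*} [Group W] {M : CoxeterMatrix B} {cs : CoxeterSystem M W}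
  {𝕜 V : Type*} [CommRing 𝕜] [AddCommGroup V] [Module 𝕜 V]

namespace Realization

def IsBalanced (𝔥 : Realization cs 𝕜 V) : Prop :=
  ∀ s t, s ≠ t → M s t ≠ 0 →
    twoColorQ (-(𝔥.root t (𝔥.coroot s))) (-(𝔥.root s (𝔥.coroot t))) (M s t - 1) = 1

def DemazureSurjective (𝔥 : Realization cs 𝕜 V) : Prop :=
  ∀ s, Function.Surjective (𝔥.root s) ∧
    Function.Surjective (fun lam : Module.Dual 𝕜 V => lam (𝔥.coroot s))

/-- The action of a simple reflection on `V^*`. -/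
def dualRefl (𝔥 : Realization cs 𝕜 V) (s : B) : Module.Dual 𝕜 V →ₗ[𝕜] Module.Dual 𝕜 V :=
  LinearMap.id - (Module.Dual.eval 𝕜 V (𝔥.coroot s)).smulRight (𝔥.root s)

/-- The action of a simple reflection on the symmetric algebra of `V^*`. -/
noncomputable def symRefl (𝔥 : Realization cs 𝕜 V) (s : B) :
    SymmetricAlgebra 𝕜 (Module.Dual 𝕜 V) →ₐ[𝕜] SymmetricAlgebra 𝕜 (Module.Dual 𝕜 V) :=
  SymmetricAlgebra.lift (SymmetricAlgebra.ι 𝕜 (Module.Dual 𝕜 V) ∘ₗ 𝔥.dualRefl s)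

end Realization

/-- The part of polynomial degree `k` of a symmetric algebra. -/
noncomputable def symDeg (𝕜 N : Type*) [CommRing 𝕜] [AddCommGroup N] [Module 𝕜 N] (k : ℕ) :
    Submodule 𝕜 (SymmetricAlgebra 𝕜 N) :=
  LinearMap.range (SymmetricAlgebra.ι 𝕜 N) ^ k

/-! ## Elias–Williamson diagrams -/

/-- The alternating word `s, t, s, …` with `n` letters. -/
def altWord (s t : B) : ℕ → List B
  | 0 => []
  | n + 1 => s :: altWord t s n

/-- Formal `𝕜`-linear combinations of horizontal and vertical concatenations of the generating
diagrams; `Diagram 𝔥 v w` has bottom boundary `v` and top boundary `w`. -/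
inductive Diagram (𝔥 : Realization cs 𝕜 V) : List B → List B → Type _
  | zero {v w : List B} : Diagram 𝔥 v w
  | add {v w : List B} (d e : Diagram 𝔥 v w) : Diagram 𝔥 v w
  | smul {v w : List B} (c : 𝕜) (d : Diagram 𝔥 v w) : Diagram 𝔥 v w
  | id (v : List B) : Diagram 𝔥 v v
  | comp {u v w : List B} (g : Diagram 𝔥 v w) (f : Diagram 𝔥 u v) : Diagram 𝔥 u w
  | tensor {v w v' w' : List B} (f : Diagram 𝔥 v w) (g : Diagram 𝔥 v' w') :
      Diagram 𝔥 (v ++ v') (w ++ w')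
  | box (f : SymmetricAlgebra 𝕜 (Module.Dual 𝕜 V)) : Diagram 𝔥 [] []
  | endDot (s : B) : Diagram 𝔥 [s] []
  | startDot (s : B) : Diagram 𝔥 [] [s]
  | split (s : B) : Diagram 𝔥 [s] [s, s]
  | merge (s : B) : Diagram 𝔥 [s, s] [s]
  | vertex (s t : B) (hst : s ≠ t) (hm : M s t ≠ 0) :
      Diagram 𝔥 (altWord s t (M s t)) (altWord t s (M s t))

namespace Diagram

variable {𝔥 : Realization cs 𝕜 V}

/-- Transport along equalities of boundary words. -/
def cast {v w v' w' : List B} (hv : v = v') (hw : w = w') (d : Diagram 𝔥 v w) :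
    Diagram 𝔥 v' w' :=
  match hv, hw with
  | rfl, rfl => d

/-- The diagram `g` with vertical strands `u` to its left and `v` to its right. -/
def layer (u v : List B) {a b x y : List B} (g : Diagram 𝔥 a b)
    (hx : u ++ (a ++ v) = x) (hy : u ++ (b ++ v) = y) : Diagram 𝔥 x y :=
  cast hx hy (tensor (id u) (tensor g (id v)))

def cap (s : B) : Diagram 𝔥 [s, s] [] := comp (endDot s) (merge s)

def cup (s : B) : Diagram 𝔥 [] [s, s] := comp (split s) (startDot s)

/-- Homogeneous diagrams, with their degree. -/
inductive IsHomog : ∀ {v w : List B}, Diagram 𝔥 v w → ℤ → Prop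
  | zero {v w : List B} (n : ℤ) : IsHomog (zero : Diagram 𝔥 v w) n
  | add {v w : List B} {d e : Diagram 𝔥 v w} {n : ℤ} :
      IsHomog d n → IsHomog e n → IsHomog (add d e) n
  | smul {v w : List B} (c : 𝕜) {d : Diagram 𝔥 v w} {n : ℤ} :
      IsHomog d n → IsHomog (smul c d) n
  | id (v : List B) : IsHomog (id v) 0
  | comp {u v w : List B} {g : Diagram 𝔥 v w} {f : Diagram 𝔥 u v} {m n : ℤ} :
      IsHomog g m → IsHomog f n → IsHomog (comp g f) (m + n)
  | tensor {v w v' w' : List B} {f : Diagram 𝔥 v w} {g : Diagram 𝔥 v' w'} {m n : ℤ} :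
      IsHomog f m → IsHomog g n → IsHomog (tensor f g) (m + n)
  | box (f : SymmetricAlgebra 𝕜 (Module.Dual 𝕜 V)) (k : ℕ)
      (hf : f ∈ symDeg 𝕜 (Module.Dual 𝕜 V) k) : IsHomog (box f) (2 * k)
  | endDot (s : B) : IsHomog (endDot s) 1
  | startDot (s : B) : IsHomog (startDot s) 1
  | split (s : B) : IsHomog (split s) (-1)
  | merge (s : B) : IsHomog (merge s) (-1)
  | vertex (s t : B) (hst : s ≠ t) (hm : M s t ≠ 0) : IsHomog (vertex s t hst hm) 0

end Diagram

open Diagram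

/-- A family of relations between parallel diagrams. -/
abbrev LocalRel (𝔥 : Realization cs 𝕜 V) :=
  ∀ v w : List B, Diagram 𝔥 v w → Diagram 𝔥 v w → Prop

/-- The congruence generated by `E`, the laws of a strict `𝕜`-linear monoidal category, and the
rule that boxes add and multiply. -/
inductive Cong {𝔥 : Realization cs 𝕜 V} (E : LocalRel 𝔥) :
    ∀ {v w : List B}, Diagram 𝔥 v w → Diagram 𝔥 v w → Prop
  | of {v w : List B} {d e : Diagram 𝔥 v w} : E v w d e → Cong E d e
  | refl {v w : List B} (d : Diagram 𝔥 v w) : Cong E d d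
  | symm {v w : List B} {d e : Diagram 𝔥 v w} : Cong E d e → Cong E e d
  | trans {v w : List B} {d e f : Diagram 𝔥 v w} : Cong E d e → Cong E e f → Cong E d f
  | add_congr {v w : List B} {d d' e e' : Diagram 𝔥 v w} :
      Cong E d d' → Cong E e e' → Cong E (add d e) (add d' e')
  | smul_congr {v w : List B} (c : 𝕜) {d d' : Diagram 𝔥 v w} :
      Cong E d d' → Cong E (smul c d) (smul c d')
  | comp_congr {u v w : List B} {g g' : Diagram 𝔥 v w} {f f' : Diagram 𝔥 u v} :
      Cong E g g' → Cong E f f' → Cong E (comp g f) (comp g' f')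
  | tensor_congr {v w v' w' : List B} {f f' : Diagram 𝔥 v w} {g g' : Diagram 𝔥 v' w'} :
      Cong E f f' → Cong E g g' → Cong E (tensor f g) (tensor f' g')
  | add_comm {v w : List B} (d e : Diagram 𝔥 v w) : Cong E (add d e) (add e d)
  | add_assoc {v w : List B} (d e f : Diagram 𝔥 v w) :
      Cong E (add (add d e) f) (add d (add e f))
  | zero_add {v w : List B} (d : Diagram 𝔥 v w) : Cong E (add zero d) d
  | neg_add {v w : List B} (d : Diagram 𝔥 v w) : Cong E (add (smul (-1) d) d) zero
  | one_smul {v w : List B} (d : Diagram 𝔥 v w) : Cong E (smul 1 d) d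
  | mul_smul {v w : List B} (a b : 𝕜) (d : Diagram 𝔥 v w) :
      Cong E (smul (a * b) d) (smul a (smul b d))
  | smul_add {v w : List B} (a : 𝕜) (d e : Diagram 𝔥 v w) :
      Cong E (smul a (add d e)) (add (smul a d) (smul a e))
  | add_smul {v w : List B} (a b : 𝕜) (d : Diagram 𝔥 v w) :
      Cong E (smul (a + b) d) (add (smul a d) (smul b d))
  | add_comp {u v w : List B} (g g' : Diagram 𝔥 v w) (f : Diagram 𝔥 u v) :
      Cong E (comp (add g g') f) (add (comp g f) (comp g' f))
  | comp_add {u v w : List B} (g : Diagram 𝔥 v w) (f f' : Diagram 𝔥 u v) :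
      Cong E (comp g (add f f')) (add (comp g f) (comp g f'))
  | smul_comp {u v w : List B} (c : 𝕜) (g : Diagram 𝔥 v w) (f : Diagram 𝔥 u v) :
      Cong E (comp (smul c g) f) (smul c (comp g f))
  | comp_smul {u v w : List B} (c : 𝕜) (g : Diagram 𝔥 v w) (f : Diagram 𝔥 u v) :
      Cong E (comp g (smul c f)) (smul c (comp g f))
  | id_comp {v w : List B} (d : Diagram 𝔥 v w) : Cong E (comp (Diagram.id w) d) d
  | comp_id {v w : List B} (d : Diagram 𝔥 v w) : Cong E (comp d (Diagram.id v)) d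
  | comp_assoc {u v w x : List B} (h : Diagram 𝔥 w x) (g : Diagram 𝔥 v w) (f : Diagram 𝔥 u v) :
      Cong E (comp (comp h g) f) (comp h (comp g f))
  | add_tensor {v w v' w' : List B} (f f' : Diagram 𝔥 v w) (g : Diagram 𝔥 v' w') :
      Cong E (tensor (add f f') g) (add (tensor f g) (tensor f' g))
  | tensor_add {v w v' w' : List B} (f : Diagram 𝔥 v w) (g g' : Diagram 𝔥 v' w') :
      Cong E (tensor f (add g g')) (add (tensor f g) (tensor f g'))
  | smul_tensor {v w v' w' : List B} (c : 𝕜) (f : Diagram 𝔥 v w) (g : Diagram 𝔥 v' w') :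
      Cong E (tensor (smul c f) g) (smul c (tensor f g))
  | tensor_smul {v w v' w' : List B} (c : 𝕜) (f : Diagram 𝔥 v w) (g : Diagram 𝔥 v' w') :
      Cong E (tensor f (smul c g)) (smul c (tensor f g))
  | id_tensor_id (v w : List B) :
      Cong E (tensor (Diagram.id v) (Diagram.id w)) (Diagram.id (v ++ w))
  | interchange {u v w u' v' w' : List B} (g : Diagram 𝔥 v w) (f : Diagram 𝔥 u v)
      (g' : Diagram 𝔥 v' w') (f' : Diagram 𝔥 u' v') :
      Cong E (tensor (comp g f) (comp g' f')) (comp (tensor g g') (tensor f f'))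
  | tensor_assoc {v w v' w' v'' w'' : List B} (f : Diagram 𝔥 v w) (g : Diagram 𝔥 v' w')
      (h : Diagram 𝔥 v'' w'') :
      Cong E (Diagram.cast (List.append_assoc _ _ _) (List.append_assoc _ _ _)
        (tensor (tensor f g) h)) (tensor f (tensor g h))
  | unit_tensor {v w : List B} (d : Diagram 𝔥 v w) : Cong E (tensor (Diagram.id []) d) d
  | tensor_unit {v w : List B} (d : Diagram 𝔥 v w) :
      Cong E (Diagram.cast (List.append_nil _) (List.append_nil _)
        (tensor d (Diagram.id []))) d
  | box_add (f g : SymmetricAlgebra 𝕜 (Module.Dual 𝕜 V)) :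
      Cong E (box (f + g)) (add (box f) (box g))
  | box_smul (c : 𝕜) (f : SymmetricAlgebra 𝕜 (Module.Dual 𝕜 V)) :
      Cong E (box (c • f)) (smul c (box f))
  | box_one : Cong E (box 1) (Diagram.id [])
  | box_mul (f g : SymmetricAlgebra 𝕜 (Module.Dual 𝕜 V)) :
      Cong E (box (f * g)) (comp (box f) (box g))

/-- The relations that involve strands of one colour. -/
inductive OneColor (𝔥 : Realization cs 𝕜 V) : LocalRel 𝔥
  | counit_right (s : B) :
      OneColor 𝔥 [s] [s] (comp (tensor (Diagram.id [s]) (endDot s)) (split s)) (Diagram.id [s])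
  | counit_left (s : B) :
      OneColor 𝔥 [s] [s] (comp (tensor (endDot s) (Diagram.id [s])) (split s)) (Diagram.id [s])
  | unit_right (s : B) :
      OneColor 𝔥 [s] [s] (comp (merge s) (tensor (Diagram.id [s]) (startDot s))) (Diagram.id [s])
  | unit_left (s : B) :
      OneColor 𝔥 [s] [s] (comp (merge s) (tensor (startDot s) (Diagram.id [s]))) (Diagram.id [s])
  | frobenius_right (s : B) :
      OneColor 𝔥 [s, s] [s, s]
        (comp (tensor (Diagram.id [s]) (merge s)) (tensor (split s) (Diagram.id [s])))
        (comp (split s) (merge s))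
  | frobenius_left (s : B) :
      OneColor 𝔥 [s, s] [s, s]
        (comp (tensor (merge s) (Diagram.id [s])) (tensor (Diagram.id [s]) (split s)))
        (comp (split s) (merge s))
  | needle (s : B) : OneColor 𝔥 [s] [s] (comp (merge s) (split s)) zero
  | barbell (s : B) :
      OneColor 𝔥 [] [] (comp (endDot s) (startDot s))
        (box (SymmetricAlgebra.ι 𝕜 (Module.Dual 𝕜 V) (𝔥.root s)))
  /-- Here `g` is the Demazure quotient `(f - s f) / α_s`. -/
  | nilHecke (s : B) (f g : SymmetricAlgebra 𝕜 (Module.Dual 𝕜 V))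
      (hg : SymmetricAlgebra.ι 𝕜 (Module.Dual 𝕜 V) (𝔥.root s) * g = f - 𝔥.symRefl s f) :
      OneColor 𝔥 [s] [s] (tensor (box f) (Diagram.id [s]))
        (add (tensor (Diagram.id [s]) (box (𝔥.symRefl s f)))
          (comp (startDot s) (comp (box g) (endDot s))))

/-- The linear combinations of diagrams `a ∘ c` that factor through a word shorter than the bottom
word, with `a` and `c` in the class `T`. -/
inductive IsLower {𝔥 : Realization cs 𝕜 V} (T : ∀ v w : List B, Diagram 𝔥 v w → Prop) :
    ∀ {v w : List B}, Diagram 𝔥 v w → Prop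
  | zero {v w : List B} : IsLower T (zero : Diagram 𝔥 v w)
  | add {v w : List B} {d e : Diagram 𝔥 v w} : IsLower T d → IsLower T e → IsLower T (add d e)
  | smul {v w : List B} (c : 𝕜) {d : Diagram 𝔥 v w} : IsLower T d → IsLower T (smul c d)
  | factor {v x w : List B} (a : Diagram 𝔥 x w) (c : Diagram 𝔥 v x) :
      T x w a → T v x c → x.length < v.length → IsLower T (comp a c)

/-- The pitchfork `u w u → u`, the image of a cap of the two-coloured Temperley–Lieb category. -/
def pitchCap {𝔥 : Realization cs 𝕜 V} (u w : B) : Diagram 𝔥 [u, w, u] [u] :=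
  comp (merge u) (tensor (Diagram.id [u]) (tensor (endDot w) (Diagram.id [u])))

/-- The pitchfork `u → u w u`, the image of a cup of the two-coloured Temperley–Lieb category. -/
def pitchCup {𝔥 : Realization cs 𝕜 V} (u w : B) : Diagram 𝔥 [u] [u, w, u] :=
  comp (tensor (Diagram.id [u]) (tensor (startDot w) (Diagram.id [u]))) (split u)

/-- Images of Temperley–Lieb diagrams in the colours `s`, `t`. -/
inductive IsTL {𝔥 : Realization cs 𝕜 V} (s t : B) :
    ∀ v w : List B, Diagram 𝔥 v w → Prop
  | id (v : List B) : IsTL s t v v (Diagram.id v)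
  | comp {u v w : List B} {g : Diagram 𝔥 v w} {f : Diagram 𝔥 u v} :
      IsTL s t v w g → IsTL s t u v f → IsTL s t u w (comp g f)
  | cap_st {a b x y : List B} (hx : a ++ ([s, t, s] ++ b) = x) (hy : a ++ ([s] ++ b) = y) :
      IsTL s t x y (layer a b (pitchCap s t) hx hy)
  | cap_ts {a b x y : List B} (hx : a ++ ([t, s, t] ++ b) = x) (hy : a ++ ([t] ++ b) = y) :
      IsTL s t x y (layer a b (pitchCap t s) hx hy)
  | cup_st {a b x y : List B} (hx : a ++ ([s] ++ b) = x) (hy : a ++ ([s, t, s] ++ b) = y) :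
      IsTL s t x y (layer a b (pitchCup s t) hx hy)
  | cup_ts {a b x y : List B} (hx : a ++ ([t] ++ b) = x) (hy : a ++ ([t, s, t] ++ b) = y) :
      IsTL s t x y (layer a b (pitchCup t s) hx hy)

/-- `J` is the Jones–Wenzl projector on the word `w` in the colours `s`, `t`: the identity plus a
combination of Temperley–Lieb diagrams through shorter words, killed by all pitchforks. -/
structure IsJonesWenzl {𝔥 : Realization cs 𝕜 V} (s t : B) (w : List B) (J : Diagram 𝔥 w w) :
    Prop where
  expand : ∃ K : Diagram 𝔥 w w, IsLower (IsTL s t) K ∧ J = add (Diagram.id w) K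
  cap_st : ∀ (a b y : List B) (hx : a ++ ([s, t, s] ++ b) = w) (hy : a ++ ([s] ++ b) = y),
    Cong (OneColor 𝔥) (comp (layer a b (pitchCap s t) hx hy) J) zero
  cap_ts : ∀ (a b y : List B) (hx : a ++ ([t, s, t] ++ b) = w) (hy : a ++ ([t] ++ b) = y),
    Cong (OneColor 𝔥) (comp (layer a b (pitchCap t s) hx hy) J) zero
  cup_st : ∀ (a b y : List B) (hx : a ++ ([s] ++ b) = y) (hy : a ++ ([s, t, s] ++ b) = w),
    Cong (OneColor 𝔥) (comp J (layer a b (pitchCup s t) hx hy)) zero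
  cup_ts : ∀ (a b y : List B) (hx : a ++ ([t] ++ b) = y) (hy : a ++ ([t, s, t] ++ b) = w),
    Cong (OneColor 𝔥) (comp J (layer a b (pitchCup t s) hx hy)) zero

/-- The relations that involve strands of two colours. In each of them `n` is `m_st - 1`, and `x`
and `y` are the last letters of the alternating words of length `m_st` starting with `s` and `t`. -/
inductive TwoColor (𝔥 : Realization cs 𝕜 V) : LocalRel 𝔥
  | cyclic_left (s t : B) (hst : s ≠ t) (hm : M s t ≠ 0) (hm' : M t s ≠ 0) (n : ℕ) (x : B)
      (h₁ : altWord s t (M s t) = altWord s t n ++ [x])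
      (h₂ : altWord t s (M s t) = t :: altWord s t n)
      (h₃ : altWord t s (M t s) = t :: altWord s t n)
      (h₄ : altWord s t (M t s) = altWord s t n ++ [x]) :
      TwoColor 𝔥 (t :: altWord s t n) (altWord s t n ++ [x])
        (comp (layer [] (altWord s t n ++ [x]) (cap t) rfl rfl)
          (comp (layer [t] [x] (vertex s t hst hm)
              (x := t :: (altWord s t n ++ [x, x])) (y := t :: t :: (altWord s t n ++ [x]))
              (by simp [h₁]) (by simp [h₂]))
            (layer (t :: altWord s t n) [] (cup x) (by simp) (by simp))))
        (Diagram.cast h₃ h₄ (vertex t s hst.symm hm'))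
  | cyclic_right (s t : B) (hst : s ≠ t) (hm : M s t ≠ 0) (hm' : M t s ≠ 0) (n : ℕ) (y : B)
      (h₁ : altWord s t (M s t) = s :: altWord t s n)
      (h₂ : altWord t s (M s t) = altWord t s n ++ [y])
      (h₃ : altWord t s (M t s) = altWord t s n ++ [y])
      (h₄ : altWord s t (M t s) = s :: altWord t s n) :
      TwoColor 𝔥 (altWord t s n ++ [y]) (s :: altWord t s n)
        (comp (layer (s :: altWord t s n) [] (cap y)
            (x := s :: (altWord t s n ++ [y, y])) (by simp) (by simp))
          (comp (layer [s] [y] (vertex s t hst hm)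
              (x := s :: s :: (altWord t s n ++ [y])) (by simp [h₁]) (by simp [h₂]))
            (layer [] (altWord t s n ++ [y]) (cup s) rfl rfl)))
        (Diagram.cast h₃ h₄ (vertex t s hst.symm hm'))
  | assoc (s t : B) (hst : s ≠ t) (hm : M s t ≠ 0) (n : ℕ) (y : B)
      (h₁ : altWord s t (M s t) = s :: altWord t s n)
      (h₂ : altWord t s (M s t) = altWord t s n ++ [y]) :
      TwoColor 𝔥 (s :: altWord t s n) (altWord t s n ++ [y, y])
        (comp (layer (altWord t s n) [] (split y) (x := altWord t s n ++ [y]) (by simp) (by simp))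
          (Diagram.cast h₁ h₂ (vertex s t hst hm)))
        (comp (layer [] [y] (vertex s t hst hm)
            (x := s :: (altWord t s n ++ [y])) (by simp [h₁]) (by simp [h₂]))
          (comp (layer [s] [] (vertex s t hst hm)
              (x := s :: s :: altWord t s n) (by simp [h₁]) (by simp [h₂]))
            (layer [] (altWord t s n) (split s) rfl rfl)))
  | jonesWenzl (s t : B) (hst : s ≠ t) (hm : M s t ≠ 0) (n : ℕ) (y : B)
      (h₁ : altWord s t (M s t) = s :: altWord t s n)
      (h₂ : altWord t s (M s t) = altWord t s n ++ [y])
      (J : Diagram 𝔥 (s :: altWord t s n) (s :: altWord t s n))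
      (hJ : IsJonesWenzl s t (s :: altWord t s n) J) :
      TwoColor 𝔥 (s :: altWord t s n) (altWord t s n)
        (comp (layer (altWord t s n) [] (endDot y) (x := altWord t s n ++ [y])
            (by simp) (by simp))
          (Diagram.cast h₁ h₂ (vertex s t hst hm)))
        (comp (layer [] (altWord t s n) (endDot s) rfl rfl) J)

/-- `IsRexPath l d`: the diagram `d` is the composite of the `2m`-valent vertices (with vertical
strands on both sides) that realize the braid moves between successive words of the list `l`. -/
inductive IsRexPath {𝔥 : Realization cs 𝕜 V} :
    List (List B) → ∀ {v w : List B}, Diagram 𝔥 v w → Prop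
  | nil (w : List B) : IsRexPath [w] (Diagram.id w)
  | cons {v w x : List B} {l : List (List B)} (s t : B) (hst : s ≠ t) (hm : M s t ≠ 0)
      (a b : List B) (hv : a ++ (altWord s t (M s t) ++ b) = v)
      (hw : a ++ (altWord t s (M s t) ++ b) = w) {d : Diagram 𝔥 w x} (hd : IsRexPath (w :: l) d) :
      IsRexPath (v :: w :: l) (comp d (layer a b (vertex s t hst hm) hv hw))

/-- `d` moves a strand coloured `u` from the left to the right across the word `w`, all of whose
letters commute with `u`, through `4`-valent vertices. -/
inductive IsSlide {𝔥 : Realization cs 𝕜 V} (u : B) :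
    ∀ w : List B, Diagram 𝔥 (u :: w) (w ++ [u]) → Prop
  | nil : IsSlide u [] (Diagram.id [u])
  | cons (a : B) (w : List B) (hua : u ≠ a) (hm : M u a ≠ 0)
      (h₁ : altWord u a (M u a) = [u, a]) (h₂ : altWord a u (M u a) = [a, u])
      {d : Diagram 𝔥 (u :: w) (w ++ [u])} (hd : IsSlide u w d) :
      IsSlide u (a :: w)
        (comp (tensor (Diagram.id [a]) d : Diagram 𝔥 ([a] ++ (u :: w)) ([a] ++ (w ++ [u])))
          (layer [] w (vertex u a hua hm) (x := u :: a :: w) (y := a :: u :: w)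
            (by simp [h₁]) (by simp [h₂])))

/-- A three-colour relation of type `H₃` for the colours `r`, `s`, `t`: two composites of braid
moves between the same two reduced expressions of the longest element agree up to a given
combination of diagrams of degree `0` that factor through shorter words. -/
structure H3Relation (𝔥 : Realization cs 𝕜 V) (r s t : B) where
  src : List B
  tgt : List B
  src_letters : ∀ a ∈ src, a = r ∨ a = s ∨ a = t
  src_reduced : cs.IsReduced src
  src_length : src.length = 15
  path₁ : Diagram 𝔥 src tgt
  path₂ : Diagram 𝔥 src tgt
  isRexPath₁ : ∃ l, IsRexPath l path₁
  isRexPath₂ : ∃ l, IsRexPath l path₂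
  lower : Diagram 𝔥 src tgt
  lower_homog : lower.IsHomog 0
  lower_isLower : IsLower (fun _ _ _ => True) lower

/-- A choice of three-colour relation for each parabolic subsystem of type `H₃`. No closed formula
for the lower terms of that relation is available, so the choice is kept as a parameter. It is
the trivial choice if `(W, S)` has no parabolic subsystem of type `H₃`. -/
abbrev H3Data (𝔥 : Realization cs 𝕜 V) :=
  ∀ r s t : B, M r s = 5 → M s t = 3 → M r t = 2 → H3Relation 𝔥 r s t

/-- The Zamolodchikov relations, of types `A₁ × I₂(m)`, `A₃`, `B₃` and `H₃`. -/
inductive ThreeColor {𝔥 : Realization cs 𝕜 V} (Z : H3Data 𝔥) : LocalRel 𝔥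
  | a1I2 (s t u : B) (hst : s ≠ t) (hm : M s t ≠ 0) (hsu : M u s = 2) (htu : M u t = 2)
      (d : Diagram 𝔥 (u :: altWord s t (M s t)) (altWord s t (M s t) ++ [u]))
      (d' : Diagram 𝔥 (u :: altWord t s (M s t)) (altWord t s (M s t) ++ [u]))
      (hd : IsSlide u _ d) (hd' : IsSlide u _ d') :
      ThreeColor Z (u :: altWord s t (M s t)) (altWord t s (M s t) ++ [u])
        (comp (tensor (vertex s t hst hm) (Diagram.id [u])) d)
        (comp d' (tensor (Diagram.id [u]) (vertex s t hst hm)))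
  | a3 (s t u : B) (hst : M s t = 3) (htu : M t u = 3) (hsu : M s u = 2)
      (d d' : Diagram 𝔥 [s, u, t, s, u, t] [t, s, u, t, s, u])
      (hd : IsRexPath [[s, u, t, s, u, t], [s, u, t, u, s, t], [s, t, u, t, s, t],
        [s, t, u, s, t, s], [s, t, s, u, t, s], [t, s, t, u, t, s], [t, s, u, t, u, s],
        [t, s, u, t, s, u]] d)
      (hd' : IsRexPath [[s, u, t, s, u, t], [u, s, t, s, u, t], [u, t, s, t, u, t],
        [u, t, s, u, t, u], [u, t, u, s, t, u], [t, u, t, s, t, u], [t, u, s, t, s, u],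
        [t, s, u, t, s, u]] d') :
      ThreeColor Z [s, u, t, s, u, t] [t, s, u, t, s, u] d d'
  | b3 (s t u : B) (hst : M s t = 4) (htu : M t u = 3) (hsu : M s u = 2)
      (d d' : Diagram 𝔥 [s, u, t, s, u, t, s, u, t] [t, s, u, t, s, u, t, s, u])
      (hd : IsRexPath [
        [s, u, t, s, u, t, s, u, t], [s, u, t, u, s, t, s, u, t], [s, t, u, t, s, t, s, u, t],
        [s, t, u, s, t, s, t, u, t], [s, t, s, u, t, s, t, u, t], [s, t, s, u, t, s, u, t, u],
        [s, t, s, u, t, u, s, t, u], [s, t, s, t, u, t, s, t, u], [t, s, t, s, u, t, s, t, u],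
        [t, s, t, u, s, t, s, t, u], [t, s, t, u, t, s, t, s, u], [t, s, u, t, u, s, t, s, u],
        [t, s, u, t, s, u, t, s, u]] d)
      (hd' : IsRexPath [
        [s, u, t, s, u, t, s, u, t], [u, s, t, s, u, t, s, u, t], [u, s, t, s, u, t, u, s, t],
        [u, s, t, s, t, u, t, s, t], [u, t, s, t, s, u, t, s, t], [u, t, s, t, u, s, t, s, t],
        [u, t, s, t, u, t, s, t, s], [u, t, s, u, t, u, s, t, s], [u, t, u, s, t, u, s, t, s],
        [t, u, t, s, t, u, s, t, s], [t, u, t, s, t, s, u, t, s], [t, u, s, t, s, t, u, t, s],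
        [t, s, u, t, s, t, u, t, s], [t, s, u, t, s, u, t, u, s], [t, s, u, t, s, u, t, s, u]] d') :
      ThreeColor Z [s, u, t, s, u, t, s, u, t] [t, s, u, t, s, u, t, s, u] d d'
  | h3 (r s t : B) (hrs : M r s = 5) (hst : M s t = 3) (hrt : M r t = 2) :
      ThreeColor Z (Z r s t hrs hst hrt).src (Z r s t hrs hst hrt).tgt
        (Z r s t hrs hst hrt).path₁
        (add (Z r s t hrs hst hrt).path₂ (Z r s t hrs hst hrt).lower)

/-- The defining relations of the Elias–Williamson diagrammatic category. -/
def ewRel {𝔥 : Realization cs 𝕜 V} (Z : H3Data 𝔥) : LocalRel 𝔥 :=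
  fun v w d e => OneColor 𝔥 v w d e ∨ TwoColor 𝔥 v w d e ∨ ThreeColor Z v w d e

/-! ## Morphism spaces of the diagrammatic category -/

variable {𝔥 : Realization cs 𝕜 V}

namespace Diagram

theorem cast_congr {E : LocalRel 𝔥} {v w v' w' : List B} (hv : v = v') (hw : w = w')
    {d e : Diagram 𝔥 v w} (h : Cong E d e) : Cong E (cast hv hw d) (cast hv hw e) := by
  subst hv hw; exact h

end Diagram

/-- The graded `𝕜`-module of morphisms `B_v → B_w` in the strict `𝕜`-linear monoidal category
presented by the generating diagrams and the relations `E`. -/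
def DHom (E : LocalRel 𝔥) (v w : List B) : Type _ :=
  Quot (fun d e : Diagram 𝔥 v w => Cong E d e)

namespace DHom

variable {E : LocalRel 𝔥} {u v w x v' w' : List B}

def mk (E : LocalRel 𝔥) {v w : List B} (d : Diagram 𝔥 v w) : DHom E v w := Quot.mk _ d

theorem ind {p : DHom E v w → Prop} (h : ∀ d, p (mk E d)) (f : DHom E v w) : p f :=
  Quot.ind h f

theorem sound {d e : Diagram 𝔥 v w} (h : Cong E d e) : mk E d = mk E e := Quot.sound h

instance : Zero (DHom E v w) := ⟨mk E zero⟩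

instance : Add (DHom E v w) :=
  ⟨Quot.map₂ add (fun _ _ _ h => .add_congr (.refl _) h) (fun _ _ _ h => .add_congr h (.refl _))⟩

instance : SMul 𝕜 (DHom E v w) := ⟨fun c => Quot.map (smul c) (fun _ _ h => .smul_congr c h)⟩

instance : Neg (DHom E v w) := ⟨fun f => (-1 : 𝕜) • f⟩

theorem mk_add (d e : Diagram 𝔥 v w) : mk E (add d e) = mk E d + mk E e := rfl

theorem mk_smul (c : 𝕜) (d : Diagram 𝔥 v w) : mk E (smul c d) = c • mk E d := rfl

theorem mk_zero : mk E (zero : Diagram 𝔥 v w) = 0 := rfl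

instance : AddCommGroup (DHom E v w) where
  add_assoc := by
    rintro ⟨d⟩ ⟨e⟩ ⟨f⟩; exact sound (.add_assoc d e f)
  add_comm := by
    rintro ⟨d⟩ ⟨e⟩; exact sound (.add_comm d e)
  zero_add := by
    rintro ⟨d⟩; exact sound (.zero_add d)
  add_zero := by
    rintro ⟨d⟩; exact sound (.trans (.add_comm d zero) (.zero_add d))
  neg_add_cancel := by
    rintro ⟨d⟩; exact sound (.neg_add d)
  nsmul := nsmulRec
  zsmul := zsmulRec

instance : Module 𝕜 (DHom E v w) where
  one_smul := by
    rintro ⟨d⟩; exact sound (.one_smul d)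
  mul_smul := by
    rintro a b ⟨d⟩; exact sound (.mul_smul a b d)
  smul_add := by
    rintro a ⟨d⟩ ⟨e⟩; exact sound (.smul_add a d e)
  add_smul := by
    rintro a b ⟨d⟩; exact sound (.add_smul a b d)
  smul_zero := by
    intro a
    have h : a • (0 : DHom E v w) + a • (0 : DHom E v w) = a • (0 : DHom E v w) := by
      have h₁ : a • ((0 : DHom E v w) + 0) = a • (0 : DHom E v w) + a • (0 : DHom E v w) :=
        sound (.smul_add a zero zero)
      rw [← h₁, add_zero]
    exact left_eq_add.mp h.symm
  zero_smul := by
    rintro ⟨d⟩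
    have h : (0 : 𝕜) • mk E d + (0 : 𝕜) • mk E d = (0 : 𝕜) • mk E d := by
      have h₁ : ((0 : 𝕜) + 0) • mk E d = (0 : 𝕜) • mk E d + (0 : 𝕜) • mk E d :=
        sound (.add_smul 0 0 d)
      rw [← h₁, add_zero]
    exact left_eq_add.mp h.symm

def id (E : LocalRel 𝔥) (v : List B) : DHom E v v := mk E (Diagram.id v)

/-- Vertical concatenation. -/
def comp : DHom E v w →ₗ[𝕜] DHom E u v →ₗ[𝕜] DHom E u w :=
  LinearMap.mk₂ 𝕜
    (Quot.map₂ Diagram.comp (fun _ _ _ h => .comp_congr (.refl _) h)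
      (fun _ _ _ h => .comp_congr h (.refl _)))
    (by rintro ⟨g⟩ ⟨g'⟩ ⟨f⟩; exact sound (.add_comp g g' f))
    (by rintro c ⟨g⟩ ⟨f⟩; exact sound (.smul_comp c g f))
    (by rintro ⟨g⟩ ⟨f⟩ ⟨f'⟩; exact sound (.comp_add g f f'))
    (by rintro c ⟨g⟩ ⟨f⟩; exact sound (.comp_smul c g f))

/-- Horizontal concatenation. -/
def tensor : DHom E v w →ₗ[𝕜] DHom E v' w' →ₗ[𝕜] DHom E (v ++ v') (w ++ w') :=
  LinearMap.mk₂ 𝕜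
    (Quot.map₂ Diagram.tensor (fun _ _ _ h => .tensor_congr (.refl _) h)
      (fun _ _ _ h => .tensor_congr h (.refl _)))
    (by rintro ⟨g⟩ ⟨g'⟩ ⟨f⟩; exact sound (.add_tensor g g' f))
    (by rintro c ⟨g⟩ ⟨f⟩; exact sound (.smul_tensor c g f))
    (by rintro ⟨g⟩ ⟨f⟩ ⟨f'⟩; exact sound (.tensor_add g f f'))
    (by rintro c ⟨g⟩ ⟨f⟩; exact sound (.tensor_smul c g f))

theorem comp_mk (g : Diagram 𝔥 v w) (f : Diagram 𝔥 u v) :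
    comp (mk E g) (mk E f) = mk E (Diagram.comp g f) := rfl

theorem tensor_mk (g : Diagram 𝔥 v w) (f : Diagram 𝔥 v' w') :
    tensor (mk E g) (mk E f) = mk E (Diagram.tensor g f) := rfl

theorem comp_assoc (h : DHom E w x) (g : DHom E v w) (f : DHom E u v) :
    comp (comp h g) f = comp h (comp g f) := by
  induction h using ind; induction g using ind; induction f using ind
  exact sound (.comp_assoc _ _ _)

theorem id_comp (f : DHom E v w) : comp (id E w) f = f := by
  induction f using ind; exact sound (.id_comp _)

theorem comp_id (f : DHom E v w) : comp f (id E v) = f := by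
  induction f using ind; exact sound (.comp_id _)

/-- The box `f`, as a linear function of `f`. -/
def box (E : LocalRel 𝔥) : SymmetricAlgebra 𝕜 (Module.Dual 𝕜 V) →ₗ[𝕜] DHom E [] [] where
  toFun f := mk E (Diagram.box f)
  map_add' f g := sound (.box_add f g)
  map_smul' c f := sound (.box_smul c f)

/-- Transport along equalities of boundary words. -/
def cast (hv : v = v') (hw : w = w') : DHom E v w →ₗ[𝕜] DHom E v' w' :=
  match hv, hw with
  | rfl, rfl => LinearMap.id

/-- The morphism `r ⋆ f`, with the box `r` to the left of `f`. -/
def boxLeft (r : SymmetricAlgebra 𝕜 (Module.Dual 𝕜 V)) : DHom E v w →ₗ[𝕜] DHom E v w :=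
  tensor (box E r)

/-- The morphism `f ⋆ r`, with the box `r` to the right of `f`. -/
def boxRight (r : SymmetricAlgebra 𝕜 (Module.Dual 𝕜 V)) : DHom E v w →ₗ[𝕜] DHom E v w :=
  cast (List.append_nil v) (List.append_nil w) ∘ₗ tensor.flip (box E r)

theorem boxLeft_add (r r' : SymmetricAlgebra 𝕜 (Module.Dual 𝕜 V)) (f : DHom E v w) :
    boxLeft (r + r') f = boxLeft r f + boxLeft r' f := by
  simp [boxLeft]

theorem boxLeft_smul (c : 𝕜) (r : SymmetricAlgebra 𝕜 (Module.Dual 𝕜 V)) (f : DHom E v w) :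
    boxLeft (c • r) f = c • boxLeft r f := by
  simp [boxLeft]

theorem boxLeft_comp (r : SymmetricAlgebra 𝕜 (Module.Dual 𝕜 V)) (g : DHom E v w)
    (f : DHom E u v) : boxLeft r (comp g f) = comp (boxLeft r g) f := by
  induction g using ind with | h g => ?_
  induction f using ind with | h f => ?_
  refine sound (.trans (.tensor_congr (.symm (.comp_id _)) (.refl _)) ?_)
  exact .trans (.interchange (Diagram.box r) (Diagram.id []) g f)
    (.comp_congr (.refl _) (.unit_tensor f))

theorem comp_boxLeft (r : SymmetricAlgebra 𝕜 (Module.Dual 𝕜 V)) (g : DHom E v w)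
    (f : DHom E u v) : comp g (boxLeft r f) = boxLeft r (comp g f) := by
  induction g using ind with | h g => ?_
  induction f using ind with | h f => ?_
  refine sound (.symm (.trans (.tensor_congr (.symm (.id_comp _)) (.refl _)) ?_))
  exact .trans (.interchange (Diagram.id []) (Diagram.box r) g f)
    (.comp_congr (.unit_tensor g) (.refl _))

/-- The morphisms of degree `n`, that is, the morphisms `B_v → B_w(n)`. -/
def deg (E : LocalRel 𝔥) (v w : List B) (n : ℤ) : Submodule 𝕜 (DHom E v w) where
  carrier := {f | ∃ d : Diagram 𝔥 v w, d.IsHomog n ∧ mk E d = f}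
  add_mem' := by
    rintro _ _ ⟨d, hd, rfl⟩ ⟨e, he, rfl⟩; exact ⟨_, .add hd he, rfl⟩
  zero_mem' := ⟨_, .zero n, rfl⟩
  smul_mem' := by
    rintro c _ ⟨d, hd, rfl⟩; exact ⟨_, .smul c hd, rfl⟩

theorem length_altWord (s t : B) (n : ℕ) : (altWord s t n).length = n := by
  induction n generalizing s t with
  | zero => rfl
  | succ n ih => simp [altWord, ih]

/-- A nonzero morphism `B_v → B_w` of degree `n` exists only if `n ≡ ℓ(v) + ℓ(w)` modulo `2`. -/
theorem mk_eq_zero_or_even {d : Diagram 𝔥 v w} {n : ℤ} (h : d.IsHomog n) :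
    mk E d = 0 ∨ Even (n + v.length + w.length) := by
  induction h with
  | zero n => exact .inl rfl
  | add _ _ h₁ h₂ =>
    rcases h₁ with h₁ | h₁
    · rcases h₂ with h₂ | h₂
      · left; rw [mk_add, h₁, h₂, add_zero]
      · exact .inr h₂
    · exact .inr h₁
  | smul c _ h =>
    rcases h with h | h
    · left; rw [mk_smul, h, smul_zero]
    · exact .inr h
  | id v => right; simp
  | comp _ _ h₁ h₂ =>
    rcases h₁ with h₁ | h₁
    · left; rw [← comp_mk, h₁, LinearMap.map_zero, LinearMap.zero_apply]
    · rcases h₂ with h₂ | h₂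
      · left; rw [← comp_mk, h₂, LinearMap.map_zero]
      · right; grind
  | tensor _ _ h₁ h₂ =>
    rcases h₁ with h₁ | h₁
    · left; rw [← tensor_mk, h₁, LinearMap.map_zero, LinearMap.zero_apply]
    · rcases h₂ with h₂ | h₂
      · left; rw [← tensor_mk, h₂, LinearMap.map_zero]
      · right; simp only [List.length_append, Nat.cast_add]; grind
  | box f k hf => right; simp
  | endDot s => right; exact ⟨1, by simp⟩
  | startDot s => right; exact ⟨1, by simp⟩
  | split s => right; exact ⟨1, by simp⟩
  | merge s => right; exact ⟨1, by simp⟩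
  | vertex s t hst hm => right; simp [length_altWord]

end DHom



/-! ## Sequences of objects of the additive hull -/

/-- A sequence of formal finite direct sums of shifted objects `B_w(n)`, almost all of them zero:
`term p` is the list of the pairs `(w, n)` of the summands `B_w(n)` in position `p`. -/
structure DSeq (B : Type*) where
  term : ℤ → List (List B × ℤ)
  finite_support : {p | term p ≠ []}.Finite

namespace DSeq

/-- The set of all summands. -/
abbrev Idx (F : DSeq B) : Type := Σ p : ℤ, Fin (F.term p).length

def pos (F : DSeq B) (a : F.Idx) : ℤ := a.1

def word (F : DSeq B) (a : F.Idx) : List B := ((F.term a.1).get a.2).1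

def shift (F : DSeq B) (a : F.Idx) : ℤ := ((F.term a.1).get a.2).2

theorem finite_idx (F : DSeq B) : Finite F.Idx := by
  have := F.finite_support.to_subtype
  refine Finite.of_injective
    (β := Σ p : {p | F.term p ≠ []}, Fin (F.term p).length)
    (fun a => ⟨⟨a.1, fun h => (Fin.cast (by simp [h]) a.2 : Fin 0).elim0⟩, a.2⟩) ?_
  rintro ⟨p, i⟩ ⟨q, j⟩ h
  obtain ⟨h₁, h₂⟩ := Sigma.mk.inj_iff.mp h
  obtain rfl : p = q := congrArg Subtype.val h₁
  exact congrArg (Sigma.mk p) (eq_of_heq h₂)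

noncomputable instance (F : DSeq B) : Fintype F.Idx :=
  have := F.finite_idx
  Fintype.ofFinite _

/-- The parity of a summand `B_w(n)` in position `p` is that of `ℓ(w) + n + p`. -/
def par (F : DSeq B) (a : F.Idx) : ℤ := (F.word a).length + F.shift a + F.pos a

end DSeq

section Complexes

variable (E : LocalRel 𝔥) {F G H K : DSeq B}

/-- The bigraded module of biequivariant morphisms `F → G`: matrices of morphisms between the
summands. Its bigrading is `BEHom.deg`. -/
abbrev BEHom (F G : DSeq B) : Type _ := ∀ (a : F.Idx) (b : G.Idx), DHom E (F.word a) (G.word b)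

namespace BEHom

/-- The part of bidegree `(i, j)`: a component from `B_w(n)` in position `p` to `B_v(m)` in
position `q` is a morphism `B_w(n) → B_v(m + j)`, and `q - p = i - j`. -/
def deg (F G : DSeq B) (i j : ℤ) : Submodule 𝕜 (BEHom E F G) where
  carrier := {f | ∀ a b,
    (G.pos b - F.pos a = i - j →
      f a b ∈ DHom.deg E (F.word a) (G.word b) (G.shift b + j - F.shift a)) ∧
    (G.pos b - F.pos a ≠ i - j → f a b = 0)}
  add_mem' hf hg a b :=
    ⟨fun h => add_mem ((hf a b).1 h) ((hg a b).1 h), fun h => by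
      simp [(hf a b).2 h, (hg a b).2 h]⟩
  zero_mem' _ _ := ⟨fun _ => zero_mem _, fun _ => rfl⟩
  smul_mem' c _ hf a b :=
    ⟨fun h => Submodule.smul_mem _ c ((hf a b).1 h), fun h => by simp [(hf a b).2 h]⟩

variable {E}

noncomputable def comp : BEHom E G H →ₗ[𝕜] BEHom E F G →ₗ[𝕜] BEHom E F H :=
  LinearMap.mk₂ 𝕜 (fun g f a c => ∑ b, DHom.comp (g b c) (f a b))
    (fun _ _ _ => by ext a c; simp [Finset.sum_add_distrib])
    (fun _ _ _ => by ext a c; simp [Finset.smul_sum])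
    (fun _ _ _ => by ext a c; simp [Finset.sum_add_distrib])
    (fun _ _ _ => by ext a c; simp [Finset.smul_sum])

theorem comp_apply (g : BEHom E G H) (f : BEHom E F G) (a : F.Idx) (c : H.Idx) :
    comp g f a c = ∑ b, DHom.comp (g b c) (f a b) := rfl

theorem comp_assoc (h : BEHom E H K) (g : BEHom E G H) (f : BEHom E F G) :
    comp (comp h g) f = comp h (comp g f) := by
  ext a c
  simp only [comp_apply, map_sum, LinearMap.sum_apply, DHom.comp_assoc]
  exact Finset.sum_comm

variable (E) in
def id (F : DSeq B) : BEHom E F F := fun a b =>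
  if h : a = b then h ▸ DHom.id E (F.word a) else 0

theorem id_comp (f : BEHom E F G) : comp (id E G) f = f := by
  ext a c
  rw [comp_apply, Finset.sum_eq_single c]
  · simp [id, DHom.id_comp]
  · intro b _ hb; simp [id, hb]
  · simp

theorem comp_id (f : BEHom E F G) : comp f (id E F) = f := by
  ext a c
  rw [comp_apply, Finset.sum_eq_single a]
  · simp [id, DHom.comp_id]
  · intro b _ hb; simp [id, Ne.symm hb]
  · simp

/-- Convolution `r ⋆ f` with an element `r` of `R = End(B_∅)`. The sign in the convolution of
morphisms is `+1` here, because `r` is in even degree. -/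
def boxLeft (r : SymmetricAlgebra 𝕜 (Module.Dual 𝕜 V)) : BEHom E F G →ₗ[𝕜] BEHom E F G where
  toFun f a b := DHom.boxLeft r (f a b)
  map_add' _ _ := by ext; simp
  map_smul' _ _ := by ext; simp

/-- Convolution `f ⋆ r` with an element `r` of `R = End(B_∅)`. The sign in the convolution of
morphisms is `+1` here, because `r` is in even degree. -/
def boxRight (r : SymmetricAlgebra 𝕜 (Module.Dual 𝕜 V)) : BEHom E F G →ₗ[𝕜] BEHom E F G where
  toFun f a b := DHom.boxRight r (f a b)
  map_add' _ _ := by ext; simp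
  map_smul' _ _ := by ext; simp

theorem boxLeft_comp (r : SymmetricAlgebra 𝕜 (Module.Dual 𝕜 V)) (g : BEHom E G H)
    (f : BEHom E F G) : boxLeft r (comp g f) = comp (boxLeft r g) f := by
  ext a c
  simp [boxLeft, comp_apply, DHom.boxLeft_comp]

theorem comp_boxLeft (r : SymmetricAlgebra 𝕜 (Module.Dual 𝕜 V)) (g : BEHom E G H)
    (f : BEHom E F G) : comp g (boxLeft r f) = boxLeft r (comp g f) := by
  ext a c
  simp [boxLeft, comp_apply, DHom.comp_boxLeft]

/-- The components of even cohomological degree, see `even_of_mem_deg`. -/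
def even : BEHom E F G →ₗ[𝕜] BEHom E F G where
  toFun f a b := if Even (F.par a + G.par b) then f a b else 0
  map_add' _ _ := by ext; simp only [Pi.add_apply]; split_ifs <;> simp
  map_smul' _ _ := by ext; simp

/-- The components of odd cohomological degree, see `odd_of_mem_deg`. -/
def odd : BEHom E F G →ₗ[𝕜] BEHom E F G where
  toFun f a b := if Even (F.par a + G.par b) then 0 else f a b
  map_add' _ _ := by ext; simp only [Pi.add_apply]; split_ifs <;> simp
  map_smul' _ _ := by ext; simp

theorem even_apply (f : BEHom E F G) (a : F.Idx) (b : G.Idx) :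
    even f a b = if Even (F.par a + G.par b) then f a b else 0 := rfl

theorem odd_apply (f : BEHom E F G) (a : F.Idx) (b : G.Idx) :
    odd f a b = if Even (F.par a + G.par b) then 0 else f a b := rfl

theorem eq_zero_of_mem_deg {f : BEHom E F G} {i j : ℤ} (hf : f ∈ deg E F G i j)
    {a : F.Idx} {b : G.Idx} (h : ¬ Even (F.par a + G.par b + i)) : f a b = 0 := by
  by_cases hp : G.pos b - F.pos a = i - j
  · obtain ⟨d, hd, hfd⟩ := (hf a b).1 hp
    rcases DHom.mk_eq_zero_or_even (E := E) hd with h0 | h0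
    · rw [← hfd, h0]
    · exfalso; apply h
      simp only [DSeq.par]
      grind
  · exact (hf a b).2 hp

theorem even_of_mem_deg {f : BEHom E F G} {i j : ℤ} (hf : f ∈ deg E F G i j) :
    even f = if Even i then f else 0 := by
  ext a b
  have := eq_zero_of_mem_deg hf (a := a) (b := b)
  rw [even_apply]
  split_ifs with h₁ h₂ h₂
  · rfl
  · exact this (by grind)
  · exact (this (by grind)).symm
  · rfl

theorem odd_of_mem_deg {f : BEHom E F G} {i j : ℤ} (hf : f ∈ deg E F G i j) :
    odd f = if Even i then 0 else f := by
  ext a b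
  have := eq_zero_of_mem_deg hf (a := a) (b := b)
  rw [odd_apply]
  split_ifs with h₁ h₂ h₂
  · rfl
  · exact (this (by grind)).symm
  · exact this (by grind)
  · rfl

theorem even_add_odd (f : BEHom E F G) : even f + odd f = f := by
  ext a b; simp only [Pi.add_apply, even_apply, odd_apply]; split_ifs <;> simp

theorem even_even (f : BEHom E F G) : even (even f) = even f := by
  ext a b; simp only [even_apply]; split_ifs <;> rfl

theorem odd_odd (f : BEHom E F G) : odd (odd f) = odd f := by
  ext a b; simp only [odd_apply]; split_ifs <;> rfl

theorem even_odd (f : BEHom E F G) : even (odd f) = 0 := by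
  ext a b; simp only [even_apply, odd_apply]; split_ifs <;> rfl

theorem odd_even (f : BEHom E F G) : odd (even f) = 0 := by
  ext a b; simp only [even_apply, odd_apply]; split_ifs <;> rfl

theorem even_comp (g : BEHom E G H) (f : BEHom E F G) :
    even (comp g f) = comp (even g) (even f) + comp (odd g) (odd f) := by
  ext a c
  simp only [Pi.add_apply, even_apply, odd_apply, comp_apply, ← Finset.sum_add_distrib]
  by_cases h : Even (F.par a + H.par c)
  · rw [if_pos h]
    refine Finset.sum_congr rfl fun b _ => ?_
    by_cases h₁ : Even (F.par a + G.par b)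
    · have h₂ : Even (G.par b + H.par c) := by grind
      simp [h₁, h₂]
    · have h₂ : ¬ Even (G.par b + H.par c) := by grind
      simp [h₁, h₂]
  · rw [if_neg h]
    refine (Finset.sum_eq_zero fun b _ => ?_).symm
    by_cases h₁ : Even (F.par a + G.par b)
    · have h₂ : ¬ Even (G.par b + H.par c) := by grind
      simp [h₁, h₂]
    · have h₂ : Even (G.par b + H.par c) := by grind
      simp [h₁, h₂]

theorem odd_comp (g : BEHom E G H) (f : BEHom E F G) :
    odd (comp g f) = comp (even g) (odd f) + comp (odd g) (even f) := by
  have h₀ : odd (comp g f) = comp g f - even (comp g f) :=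
    eq_sub_of_add_eq' (even_add_odd _)
  have h' : comp g f = comp (even g + odd g) (even f + odd f) := by
    rw [even_add_odd, even_add_odd]
  rw [h₀, even_comp, h']
  simp only [map_add, LinearMap.add_apply]
  abel

theorem even_boxLeft (r : SymmetricAlgebra 𝕜 (Module.Dual 𝕜 V)) (f : BEHom E F G) :
    even (boxLeft r f) = boxLeft r (even f) := by
  ext a b; simp only [even_apply, boxLeft, LinearMap.coe_mk, AddHom.coe_mk]; split_ifs <;> simp

theorem odd_boxLeft (r : SymmetricAlgebra 𝕜 (Module.Dual 𝕜 V)) (f : BEHom E F G) :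
    odd (boxLeft r f) = boxLeft r (odd f) := by
  ext a b; simp only [odd_apply, boxLeft, LinearMap.coe_mk, AddHom.coe_mk]; split_ifs <;> simp

theorem even_id : even (id E F) = id E F := by
  ext a b
  simp only [even_apply]
  split_ifs with h
  · rfl
  · have : a ≠ b := by
      rintro rfl; exact h ⟨F.par a, rfl⟩
    simp [id, this]

theorem odd_id : odd (id E F) = 0 := by
  rw [← even_id, odd_even]

end BEHom

/-! ## Free-monodromic complexes -/

open scoped TensorProduct

theorem contractLeft_mul (d : Module.Dual 𝕜 (Module.Dual 𝕜 V))
    (a b : ExteriorAlgebra 𝕜 (Module.Dual 𝕜 V)) :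
    CliffordAlgebra.contractLeft d (a * b) =
      CliffordAlgebra.contractLeft d a * b +
        CliffordAlgebra.involute a * CliffordAlgebra.contractLeft d b := by
  induction a using CliffordAlgebra.left_induction with
  | algebraMap r => simp [CliffordAlgebra.contractLeft_algebraMap_mul]
  | add x y hx hy => simp only [add_mul, map_add, hx, hy]; abel
  | ι_mul x m hx =>
    rw [mul_assoc, CliffordAlgebra.contractLeft_ι_mul, hx, CliffordAlgebra.contractLeft_ι_mul,
      map_mul, CliffordAlgebra.involute_ι]
    simp only [mul_add, sub_mul, smul_mul_assoc, neg_mul, mul_assoc]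
    abel

theorem contractLeft_involute (d : Module.Dual 𝕜 (Module.Dual 𝕜 V))
    (a : ExteriorAlgebra 𝕜 (Module.Dual 𝕜 V)) :
    CliffordAlgebra.contractLeft d (CliffordAlgebra.involute a) =
      -CliffordAlgebra.involute (CliffordAlgebra.contractLeft d a) := by
  induction a using CliffordAlgebra.left_induction with
  | algebraMap r => simp
  | add x y hx hy => simp only [map_add, hx, hy, neg_add]
  | ι_mul x m hx =>
    simp only [map_mul, CliffordAlgebra.involute_ι, neg_mul, map_neg,
      CliffordAlgebra.contractLeft_ι_mul, hx, map_sub, map_smul, mul_neg]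

/-- The bigraded module `Λ ⊗ Hom_BE(F, G) ⊗ R^∨`, where `Λ` is the exterior algebra of `V^*` and
`R^∨` is the symmetric algebra of `V`. Its bigrading is `FMHom.deg`. -/
abbrev FMHom (F G : DSeq B) : Type _ :=
  ExteriorAlgebra 𝕜 (Module.Dual 𝕜 V) ⊗[𝕜] (BEHom E F G ⊗[𝕜] SymmetricAlgebra 𝕜 V)

namespace FMHom

/-- The part of bidegree `(i, j)`, where `V^* ⊆ Λ` is in bidegree `(1, 2)` and `V ⊆ R^∨` is in
bidegree `(0, -2)`. -/
def deg (F G : DSeq B) (i j : ℤ) : Submodule 𝕜 (FMHom E F G) :=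
  Submodule.span 𝕜 {z | ∃ (k l : ℕ) (a b : ℤ), k + a = i ∧ 2 * k + b - 2 * l = j ∧
    ∃ r ∈ ⋀[𝕜]^k (Module.Dual 𝕜 V), ∃ f ∈ BEHom.deg E F G a b, ∃ x ∈ symDeg 𝕜 V l,
      z = r ⊗ₜ (f ⊗ₜ x)}

variable {E}

theorem ind {p : FMHom E F G → Prop} (z : FMHom E F G) (h0 : p 0)
    (ht : ∀ r f x, p (r ⊗ₜ (f ⊗ₜ x))) (ha : ∀ a b, p a → p b → p (a + b)) : p z := by
  induction z using TensorProduct.induction_on with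
  | zero => exact h0
  | add a b hx hy => exact ha a b hx hy
  | tmul r y =>
    induction y using TensorProduct.induction_on with
    | zero => rw [TensorProduct.tmul_zero]; exact h0
    | add a b hx hy => rw [TensorProduct.tmul_add]; exact ha _ _ hx hy
    | tmul f x => exact ht r f x

/-- The linear map `r ⊗ f ⊗ x ↦ A(r) ⊗ P(f) ⊗ x`. -/
noncomputable def mapLam
    (A : ExteriorAlgebra 𝕜 (Module.Dual 𝕜 V) →ₗ[𝕜] ExteriorAlgebra 𝕜 (Module.Dual 𝕜 V))
    (P : BEHom E F G →ₗ[𝕜] BEHom E F G) : FMHom E F G →ₗ[𝕜] FMHom E F G :=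
  TensorProduct.map A (TensorProduct.map P LinearMap.id)

theorem mapLam_tmul
    (A : ExteriorAlgebra 𝕜 (Module.Dual 𝕜 V) →ₗ[𝕜] ExteriorAlgebra 𝕜 (Module.Dual 𝕜 V))
    (P : BEHom E F G →ₗ[𝕜] BEHom E F G) (r : ExteriorAlgebra 𝕜 (Module.Dual 𝕜 V))
    (f : BEHom E F G) (x : SymmetricAlgebra 𝕜 V) :
    mapLam A P (r ⊗ₜ (f ⊗ₜ x)) = A r ⊗ₜ (P f ⊗ₜ x) := rfl

/-- The linear map `r ↦ (-1)^{|r|} r`. -/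
def lamSgn : ExteriorAlgebra 𝕜 (Module.Dual 𝕜 V) →ₗ[𝕜] ExteriorAlgebra 𝕜 (Module.Dual 𝕜 V) :=
  CliffordAlgebra.involute.toLinearMap

theorem lamSgn_apply (r : ExteriorAlgebra 𝕜 (Module.Dual 𝕜 V)) :
    lamSgn r = CliffordAlgebra.involute r := rfl

/-- The operator `z ↦ (-1)^{|z|} z`, where `|z|` is the cohomological degree. -/
noncomputable def sgn : FMHom E F G →ₗ[𝕜] FMHom E F G :=
  mapLam lamSgn (BEHom.even - BEHom.odd)

theorem sgn_tmul (r : ExteriorAlgebra 𝕜 (Module.Dual 𝕜 V))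
    (f : BEHom E F G) (x : SymmetricAlgebra 𝕜 V) :
    sgn (r ⊗ₜ[𝕜] (f ⊗ₜ[𝕜] x)) =
      CliffordAlgebra.involute r ⊗ₜ[𝕜] ((BEHom.even f - BEHom.odd f) ⊗ₜ[𝕜] x) := rfl

/-- Composition without signs, `(r ⊗ f ⊗ x)(s ⊗ g ⊗ y) = rs ⊗ fg ⊗ xy`. -/
noncomputable def rawComp : FMHom E G H →ₗ[𝕜] FMHom E F G →ₗ[𝕜] FMHom E F H :=
  TensorProduct.map₂ (LinearMap.mul 𝕜 (ExteriorAlgebra 𝕜 (Module.Dual 𝕜 V)))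
    (TensorProduct.map₂ BEHom.comp (LinearMap.mul 𝕜 (SymmetricAlgebra 𝕜 V)))

/-- Composition, `(r ⊗ f ⊗ x) ∘ (s ⊗ g ⊗ y) = (-1)^{|f||s|} rs ⊗ fg ⊗ xy`. -/
noncomputable def comp : FMHom E G H →ₗ[𝕜] FMHom E F G →ₗ[𝕜] FMHom E F H :=
  rawComp ∘ₗ mapLam LinearMap.id BEHom.even +
    rawComp.compl₁₂ (mapLam LinearMap.id BEHom.odd) (mapLam lamSgn LinearMap.id)

theorem comp_tmul (r s : ExteriorAlgebra 𝕜 (Module.Dual 𝕜 V)) (f : BEHom E G H)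
    (g : BEHom E F G) (x y : SymmetricAlgebra 𝕜 V) :
    comp (r ⊗ₜ[𝕜] (f ⊗ₜ[𝕜] x)) (s ⊗ₜ[𝕜] (g ⊗ₜ[𝕜] y)) =
      (r * s) ⊗ₜ[𝕜] (BEHom.comp (BEHom.even f) g ⊗ₜ[𝕜] (x * y)) +
      (r * CliffordAlgebra.involute s) ⊗ₜ[𝕜] (BEHom.comp (BEHom.odd f) g ⊗ₜ[𝕜] (x * y)) := rfl

theorem comp_assoc (h : FMHom E H K) (g : FMHom E G H) (f : FMHom E F G) :
    comp (comp h g) f = comp h (comp g f) := by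
  induction h using ind with
  | h0 => simp
  | ha a b ha hb => simp only [map_add, LinearMap.add_apply, ha, hb]
  | ht r₁ f₁ x₁ =>
  induction g using ind with
  | h0 => simp
  | ha a b ha hb => simp only [map_add, LinearMap.add_apply, ha, hb]
  | ht r₂ f₂ x₂ =>
  induction f using ind with
  | h0 => simp
  | ha a b ha hb => simp only [map_add, ha, hb]
  | ht r₃ f₃ x₃ =>
  simp only [comp_tmul, map_add, LinearMap.add_apply, BEHom.even_comp, BEHom.odd_comp,
    BEHom.even_even, BEHom.even_odd, BEHom.odd_even, BEHom.odd_odd, map_zero,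
    LinearMap.zero_apply, add_zero, zero_add, BEHom.comp_assoc, mul_assoc, map_mul, CliffordAlgebra.involute_involute]
  abel

variable (E) in
noncomputable def id (F : DSeq B) : FMHom E F F := 1 ⊗ₜ (BEHom.id E F ⊗ₜ 1)

theorem id_comp (f : FMHom E F G) : comp (id E G) f = f := by
  induction f using ind with
  | h0 => simp
  | ha a b ha hb => simp only [map_add, ha, hb]
  | ht r f x =>
    simp [id, comp_tmul, BEHom.even_id, BEHom.odd_id, BEHom.id_comp]

theorem comp_id (f : FMHom E F G) : comp f (id E F) = f := by
  induction f using ind with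
  | h0 => simp
  | ha a b ha hb => simp only [map_add, LinearMap.add_apply, ha, hb]
  | ht r f x =>
    simp only [id, comp_tmul, map_one, mul_one, BEHom.comp_id]
    rw [← TensorProduct.tmul_add, ← TensorProduct.add_tmul, BEHom.even_add_odd]

theorem sgn_comp (g : FMHom E G H) (f : FMHom E F G) :
    sgn (comp g f) = comp (sgn g) (sgn f) := by
  induction g using ind with
  | h0 => simp
  | ha a b ha hb => simp only [map_add, LinearMap.add_apply, ha, hb]
  | ht r₁ f₁ x₁ =>
  induction f using ind with
  | h0 => simp
  | ha a b ha hb => simp only [map_add, ha, hb]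
  | ht r₂ f₂ x₂ =>
  simp only [comp_tmul, sgn_tmul, map_add, map_sub, LinearMap.sub_apply, BEHom.even_comp,
    BEHom.odd_comp, BEHom.even_even, BEHom.even_odd, BEHom.odd_even, BEHom.odd_odd, map_zero,
    LinearMap.zero_apply, TensorProduct.tmul_zero, TensorProduct.zero_tmul, add_zero, zero_add,
    map_mul, CliffordAlgebra.involute_involute, TensorProduct.sub_tmul, TensorProduct.tmul_sub]
  abel

theorem sgn_sgn (f : FMHom E F G) : sgn (sgn f) = f := by
  induction f using ind with
  | h0 => simp
  | ha a b ha hb => simp only [map_add, ha, hb]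
  | ht r f x =>
    simp only [sgn_tmul, map_sub, BEHom.even_even, BEHom.even_odd, BEHom.odd_even, BEHom.odd_odd,
      CliffordAlgebra.involute_involute, sub_zero, zero_sub, sub_neg_eq_add, BEHom.even_add_odd]

theorem sgn_id : sgn (id E F) = id E F := by
  simp [id, sgn_tmul, BEHom.even_id, BEHom.odd_id]

theorem involute_of_mem {k : ℕ} {r : ExteriorAlgebra 𝕜 (Module.Dual 𝕜 V)}
    (hr : r ∈ ⋀[𝕜]^k (Module.Dual 𝕜 V)) : CliffordAlgebra.involute r = (-1 : 𝕜) ^ k • r := by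
  induction hr using Submodule.pow_induction_on_left' with
  | algebraMap r => simp
  | add x y i hx hy h₁ h₂ => rw [map_add, h₁, h₂, smul_add]
  | mem_mul m hm i x hx h =>
    obtain ⟨v, rfl⟩ := hm
    rw [map_mul, h, CliffordAlgebra.involute_ι, pow_succ]
    simp

theorem sgn_of_mem_deg {z : FMHom E F G} {i j : ℤ} (hz : z ∈ deg E F G i j) :
    sgn z = if Even i then z else -z := by
  induction hz using Submodule.span_induction with
  | mem z h =>
    obtain ⟨k, l, a, b, rfl, rfl, r, hr, f, hf, x, hx, rfl⟩ := h
    rw [sgn_tmul, involute_of_mem hr, BEHom.even_of_mem_deg hf, BEHom.odd_of_mem_deg hf]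
    rcases Nat.even_or_odd k with hk | hk <;> rcases Int.even_or_odd a with ha | ha
    · have : Even ((k : ℤ) + a) := by grind
      simp [hk.neg_one_pow, ha, this]
    · have h₁ : ¬ Even ((k : ℤ) + a) := by grind
      have h₂ : ¬ Even a := by grind
      simp [hk.neg_one_pow, h₁, h₂, TensorProduct.neg_tmul, TensorProduct.tmul_neg]
    · have h₁ : ¬ Even ((k : ℤ) + a) := by grind
      simp [hk.neg_one_pow, h₁, ha, TensorProduct.neg_tmul]
    · have h₁ : Even ((k : ℤ) + a) := by grind
      have h₂ : ¬ Even a := by grind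
      simp [hk.neg_one_pow, h₁, h₂, TensorProduct.neg_tmul, TensorProduct.tmul_neg]
  | zero => simp
  | add a b _ _ ha hb => rw [map_add, ha, hb]; split_ifs <;> abel
  | smul c a _ ha => rw [map_smul, ha]; split_ifs <;> simp

/-- The contraction `x ⌢ (r ⊗ f ⊗ y) = (x ⌢ r) ⊗ f ⊗ y` with `x ∈ V`. -/
noncomputable def contract (x : V) : FMHom E F G →ₗ[𝕜] FMHom E F G :=
  mapLam (CliffordAlgebra.contractLeft (Module.Dual.eval 𝕜 V x)) LinearMap.id

/-- The right action `(r ⊗ f ⊗ x) · y = r ⊗ f ⊗ xy` of `R^∨`. -/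
noncomputable def rightMul (y : SymmetricAlgebra 𝕜 V) : FMHom E F G →ₗ[𝕜] FMHom E F G :=
  TensorProduct.map LinearMap.id
    (TensorProduct.map LinearMap.id (LinearMap.mulRight 𝕜 y))

section Koszul

variable [Module.Free 𝕜 V] [Module.Finite 𝕜 V]

/-- The Koszul differential `r ⊗ f ⊗ x ↦ ∑ᵢ (ěᵢ ⌢ r) ⊗ (eᵢ ⋆ f) ⊗ x`, for a basis `(ěᵢ)` of `V`
with dual basis `(eᵢ)`; see `kappa_one` and `kappa_ι_mul` for its explicit form. -/
noncomputable def kappa : FMHom E F G →ₗ[𝕜] FMHom E F G :=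
  ∑ i, mapLam
    (CliffordAlgebra.contractLeft (Module.Dual.eval 𝕜 V (Module.Free.chooseBasis 𝕜 V i)))
    (BEHom.boxLeft (SymmetricAlgebra.ι 𝕜 (Module.Dual 𝕜 V)
      ((Module.Free.chooseBasis 𝕜 V).coord i)))

theorem kappa_tmul (r : ExteriorAlgebra 𝕜 (Module.Dual 𝕜 V))
    (f : BEHom E F G) (x : SymmetricAlgebra 𝕜 V) :
    kappa (r ⊗ₜ[𝕜] (f ⊗ₜ[𝕜] x)) = ∑ i,
      CliffordAlgebra.contractLeft (Module.Dual.eval 𝕜 V (Module.Free.chooseBasis 𝕜 V i)) r ⊗ₜ[𝕜]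
        (BEHom.boxLeft (SymmetricAlgebra.ι 𝕜 (Module.Dual 𝕜 V)
          ((Module.Free.chooseBasis 𝕜 V).coord i)) f ⊗ₜ[𝕜] x) := by
  simp only [kappa, LinearMap.sum_apply, mapLam_tmul]

theorem kappa_one (f : BEHom E F G) (x : SymmetricAlgebra 𝕜 V) :
    kappa ((1 : ExteriorAlgebra 𝕜 (Module.Dual 𝕜 V)) ⊗ₜ[𝕜] (f ⊗ₜ[𝕜] x)) = 0 := by
  simp [kappa_tmul]

theorem boxLeft_sum_coord (v : Module.Dual 𝕜 V) (f : BEHom E F G) :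
    ∑ i, v (Module.Free.chooseBasis 𝕜 V i) •
      BEHom.boxLeft (SymmetricAlgebra.ι 𝕜 (Module.Dual 𝕜 V)
        ((Module.Free.chooseBasis 𝕜 V).coord i)) f =
      BEHom.boxLeft (SymmetricAlgebra.ι 𝕜 (Module.Dual 𝕜 V) v) f := by
  have hv : v = ∑ i, v (Module.Free.chooseBasis 𝕜 V i) • (Module.Free.chooseBasis 𝕜 V).coord i :=
    ((Module.Free.chooseBasis 𝕜 V).sum_dual_apply_smul_coord v).symm
  ext a b
  conv_rhs => rw [hv]
  simp only [Finset.sum_apply, Pi.smul_apply, BEHom.boxLeft, LinearMap.coe_mk, AddHom.coe_mk,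
    map_sum, map_smul, DHom.boxLeft, LinearMap.sum_apply, LinearMap.smul_apply]

theorem kappa_ι_mul (v : Module.Dual 𝕜 V) (r : ExteriorAlgebra 𝕜 (Module.Dual 𝕜 V))
    (f : BEHom E F G) (x : SymmetricAlgebra 𝕜 V) :
    kappa ((ExteriorAlgebra.ι 𝕜 v * r) ⊗ₜ[𝕜] (f ⊗ₜ[𝕜] x)) =
      r ⊗ₜ[𝕜] (BEHom.boxLeft (SymmetricAlgebra.ι 𝕜 (Module.Dual 𝕜 V) v) f ⊗ₜ[𝕜] x) -
        comp (ExteriorAlgebra.ι 𝕜 v ⊗ₜ[𝕜] (BEHom.id E G ⊗ₜ[𝕜] 1))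
          (kappa (r ⊗ₜ[𝕜] (f ⊗ₜ[𝕜] x))) := by
  rw [← boxLeft_sum_coord, kappa_tmul, kappa_tmul, map_sum, TensorProduct.sum_tmul,
    TensorProduct.tmul_sum, ← Finset.sum_sub_distrib]
  refine Finset.sum_congr rfl fun i _ => ?_
  rw [CliffordAlgebra.contractLeft_ι_mul, comp_tmul, BEHom.even_id, BEHom.odd_id, BEHom.id_comp]
  simp [TensorProduct.sub_tmul, TensorProduct.smul_tmul]

theorem kappa_comp (g : FMHom E G H) (f : FMHom E F G) :
    kappa (comp g f) = comp (kappa g) f + comp (sgn g) (kappa f) := by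
  induction g using ind with
  | h0 => simp
  | ha a b ha hb => simp only [map_add, LinearMap.add_apply, ha, hb]; abel
  | ht r₁ f₁ x₁ =>
  induction f using ind with
  | h0 => simp
  | ha a b ha hb => simp only [map_add, ha, hb]; abel
  | ht r₂ f₂ x₂ =>
  simp only [comp_tmul, kappa_tmul, sgn_tmul, map_add, map_sum, LinearMap.sum_apply,
    ← Finset.sum_add_distrib]
  refine Finset.sum_congr rfl fun i _ => ?_
  simp only [contractLeft_mul, contractLeft_involute, map_sub, BEHom.even_even, BEHom.even_odd,
    BEHom.odd_even, BEHom.odd_odd, BEHom.even_boxLeft, BEHom.odd_boxLeft, BEHom.boxLeft_comp,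
    sub_zero, zero_sub, map_neg, LinearMap.neg_apply, TensorProduct.neg_tmul,
    TensorProduct.tmul_neg, TensorProduct.add_tmul, mul_neg, BEHom.comp_boxLeft]
  abel

theorem kappa_sgn (f : FMHom E F G) : kappa (sgn f) = -sgn (kappa f) := by
  induction f using ind with
  | h0 => simp
  | ha a b ha hb => simp only [map_add, ha, hb]; abel
  | ht r f x =>
    simp only [sgn_tmul, kappa_tmul, map_sum, ← Finset.sum_neg_distrib, contractLeft_involute,
      map_sub, BEHom.even_boxLeft, BEHom.odd_boxLeft, TensorProduct.neg_tmul]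

variable (E) in
/-- The element `Θ = ∑ᵢ 1 ⊗ (id ⋆ eᵢ) ⊗ ěᵢ`, for a basis `(ěᵢ)` of `V` with dual basis `(eᵢ)`. -/
noncomputable def Theta (F : DSeq B) : FMHom E F F :=
  ∑ i, 1 ⊗ₜ (BEHom.boxRight (SymmetricAlgebra.ι 𝕜 (Module.Dual 𝕜 V)
      ((Module.Free.chooseBasis 𝕜 V).coord i)) (BEHom.id E F) ⊗ₜ
    SymmetricAlgebra.ι 𝕜 V (Module.Free.chooseBasis 𝕜 V i))

end Koszul

end FMHom

variable [Module.Free 𝕜 V] [Module.Finite 𝕜 V]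

/-- Free-monodromic complexes. -/
structure FMObj where
  seq : DSeq B
  δ : FMHom E seq seq
  δ_mem : δ ∈ FMHom.deg E seq seq 1 0
  δ_comp_δ : FMHom.comp δ δ + FMHom.kappa δ = FMHom.Theta E seq

variable {E}

namespace FMObj

/-- The differential `f ↦ κ(f) + δ_G ∘ f - (-1)^{|f|} f ∘ δ_F` of the complex of morphisms. -/
noncomputable def diff (F G : FMObj E) : FMHom E F.seq G.seq →ₗ[𝕜] FMHom E F.seq G.seq :=
  FMHom.kappa + FMHom.comp G.δ - FMHom.comp.flip F.δ ∘ₗ FMHom.sgn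

theorem diff_apply (F G : FMObj E) (f : FMHom E F.seq G.seq) :
    diff F G f = FMHom.kappa f + FMHom.comp G.δ f - FMHom.comp (FMHom.sgn f) F.δ := rfl

theorem sgn_δ (F : FMObj E) : FMHom.sgn F.δ = -F.δ := by
  simp [FMHom.sgn_of_mem_deg F.δ_mem]

theorem diff_comp {F G H : FMObj E} (g : FMHom E G.seq H.seq) (f : FMHom E F.seq G.seq) :
    diff F H (FMHom.comp g f) =
      FMHom.comp (diff G H g) f + FMHom.comp (FMHom.sgn g) (diff F G f) := by
  simp only [diff_apply, FMHom.kappa_comp, FMHom.sgn_comp, map_add, map_sub, LinearMap.add_apply,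
    LinearMap.sub_apply, FMHom.comp_assoc]
  abel

theorem diff_sgn {F G : FMObj E} (f : FMHom E F.seq G.seq) :
    diff F G (FMHom.sgn f) = -FMHom.sgn (diff F G f) := by
  simp only [diff_apply, FMHom.kappa_sgn, map_add, map_sub, FMHom.sgn_comp, sgn_δ,
    FMHom.sgn_sgn, map_neg, LinearMap.neg_apply]
  abel

theorem diff_id (F : FMObj E) : diff F F (FMHom.id E F.seq) = 0 := by
  rw [diff_apply, FMHom.sgn_id, FMHom.comp_id, FMHom.id_comp, FMHom.id, FMHom.kappa_one]
  abel

end FMObj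

/-- The cohomology of the complex of morphisms `F → G`. Its bigrading is `gHom.deg`. -/
abbrev gHom (F G : FMObj E) : Type _ := Cohomology (FMObj.diff F G)

namespace gHom

variable {F G H K : FMObj E}

/-- The class of a cocycle. -/
noncomputable abbrev mk (f : FMHom E F.seq G.seq) (hf : FMObj.diff F G f = 0) : gHom F G :=
  Cohomology.mk f hf

/-- The part of bidegree `(i, j)`: the classes of the cocycles of bidegree `(i, j)`. -/
noncomputable def deg (F G : FMObj E) (i j : ℤ) : Submodule 𝕜 (gHom F G) :=
  Cohomology.classes _ (FMHom.deg E F.seq G.seq i j)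

theorem diff_comp_eq_zero (g : FMHom E G.seq H.seq) (f : FMHom E F.seq G.seq)
    (hg : FMObj.diff G H g = 0) (hf : FMObj.diff F G f = 0) :
    FMObj.diff F H (FMHom.comp g f) = 0 := by
  rw [FMObj.diff_comp, hg, hf, map_zero, map_zero, LinearMap.zero_apply, add_zero]

/-- Composition of cohomology classes. -/
noncomputable def comp : gHom G H →ₗ[𝕜] gHom F G →ₗ[𝕜] gHom F H :=
  Cohomology.map₂ FMHom.comp diff_comp_eq_zero
    (fun h f hf => ⟨FMHom.comp h f, by rw [FMObj.diff_comp, hf, map_zero, add_zero]⟩)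
    (fun g h hg => ⟨FMHom.comp (FMHom.sgn g) h, by
      rw [FMObj.diff_comp, FMObj.diff_sgn, hg, FMHom.sgn_sgn, map_zero, neg_zero, map_zero,
        LinearMap.zero_apply, zero_add]⟩)

theorem comp_mk (g : FMHom E G.seq H.seq) (hg : FMObj.diff G H g = 0)
    (f : FMHom E F.seq G.seq) (hf : FMObj.diff F G f = 0) :
    comp (mk g hg) (mk f hf) = mk (FMHom.comp g f) (diff_comp_eq_zero g f hg hf) := rfl

theorem comp_assoc (h : gHom H K) (g : gHom G H) (f : gHom F G) :
    comp (comp h g) f = comp h (comp g f) := by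
  induction h using Cohomology.ind
  induction g using Cohomology.ind
  induction f using Cohomology.ind
  simp only [comp_mk, FMHom.comp_assoc]

noncomputable instance : One (gHom F F) := ⟨gHom.mk (FMHom.id E F.seq) (FMObj.diff_id F)⟩

noncomputable instance : Mul (gHom F F) := ⟨fun g f => comp g f⟩

theorem one_def : (1 : gHom F F) = mk (FMHom.id E F.seq) (FMObj.diff_id F) := rfl

theorem mul_def (g f : gHom F F) : g * f = comp g f := rfl

theorem one_comp (f : gHom F G) : comp 1 f = f := by
  induction f using Cohomology.ind
  simp only [one_def, comp_mk, FMHom.id_comp]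

theorem comp_one (f : gHom F G) : comp f 1 = f := by
  induction f using Cohomology.ind
  simp only [one_def, comp_mk, FMHom.comp_id]

/-- The algebra `gEnd(F)`, in which the product is the composition. -/
noncomputable instance : Ring (gHom F F) where
  __ := (inferInstance : AddCommGroup (gHom F F))
  mul_assoc := comp_assoc
  one_mul := one_comp
  mul_one := comp_one
  left_distrib g f f' := map_add (comp g) f f'
  right_distrib g g' f := by rw [mul_def, map_add]; rfl
  zero_mul f := by rw [mul_def, map_zero]; rfl
  mul_zero g := map_zero (comp g)

noncomputable instance : Algebra 𝕜 (gHom F F) :=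
  Algebra.ofModule (fun c g f => by rw [mul_def, map_smul]; rfl)
    (fun c g f => map_smul (comp g) c f)

end gHom

end Complexes

end EliasWilliamson

/-! Everything on the left comes from one operator, contraction with `x ∈ V`. On morphism spaces it
is an odd derivation for the signed composition (`contract_comp`), it anticommutes with `κ` because
any two contractions anticommute (`contract_kappa`), and it kills `Θ`, whose exterior component is
`1` (`contract_Theta`).

Applied to `δ ∘ δ + κ(δ) = Θ`, it yields exactly the statement that `x ⌢ δ` is a cocycle, since `x ⌢
δ` has even degree `(0, -2)` (`diff_contract_δ`). Applied to the formula for `d`, it yields the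
homotopy identity `d(x ⌢ f) + x ⌢ d(f) = (x ⌢ δ_G) ∘ f - f ∘ (x ⌢ δ_F)` (`diff_contract`). In
cohomology the classes `[x ⌢ δ]` therefore commute with every morphism (`contractClass_comp`). For
`F = G` this makes them central in `gEnd(F)`, so they commute with each other and the linear map `x
↦ [x ⌢ δ_F]` extends uniquely to `Sym(V)`. The intertwining property passes from the generators `V`
to all of `Sym(V)` because it survives sums and products (`monodromy_comp`), and left monodromy is
composition with `μ_G(x)`.

Right monodromy needs no homotopy. The factor `R^∨` is commutative and carries no cohomological
degree, so multiplication on it commutes with composition, with the sign operator and with `κ`,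
hence with `d`. The two actions commute because the left one is a composition.

The sign `(-1)^{|f|}` is the linear operator `sgn`, defined on all morphisms, so the identities
above hold without any homogeneity assumption on `f`. Homogeneous elements matter only for the
bigrading and for the parity of `δ` and `x ⌢ δ`. -/

namespace Cohomology

/-! ### Induced maps and homogeneous classes in cohomology -/

variable {𝕜 X : Type*} [CommRing 𝕜] [AddCommGroup X] [Module 𝕜 X] {d : X →ₗ[𝕜] X}

/-- The cocycle proof is an argument of `mk`, so an identity of cochains cannot always be rewritten
under it. This lemma transports such identities to classes, whatever the two proofs are. -/
theorem mk_congr {x y : X} (h : x = y) (hx : d x = 0) (hy : d y = 0) :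
    (mk x hx : Cohomology d) = mk y hy := by
  subst h; rfl

/-- The endomorphism of the cohomology induced by an endomorphism that commutes with `d`. -/
def map (T : X →ₗ[𝕜] X) (h : ∀ x, d (T x) = T (d x)) : Cohomology d →ₗ[𝕜] Cohomology d :=
  Submodule.mapQ _ _
    (T.restrict (p := LinearMap.ker d) (q := LinearMap.ker d)
      fun x hx => by rw [LinearMap.mem_ker, h, LinearMap.mem_ker.mp hx, map_zero])
    (by
      rintro ⟨_, _⟩ ⟨x, rfl⟩
      exact ⟨T x, h x⟩)

theorem mk_mem_classes {N : Submodule 𝕜 X} {x : X} (hx : d x = 0) (h : x ∈ N) :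
    mk x hx ∈ classes d N := ⟨⟨x, hx⟩, h, rfl⟩

/-- Used to choose a homogeneous cocycle representing a homogeneous class, which reduces degree
claims in cohomology to degree claims on cochains. -/
theorem exists_of_mem_classes {N : Submodule 𝕜 X} {z : Cohomology d} (h : z ∈ classes d N) :
    ∃ x, ∃ hx : d x = 0, x ∈ N ∧ mk x hx = z := by
  obtain ⟨⟨x, hx⟩, h, rfl⟩ := h
  exact ⟨x, hx, h, rfl⟩

end Cohomology

/-! ### Degrees in symmetric and exterior algebras -/

section Monodromy

open scoped TensorProduct

variable {B W : Type*} [Group W] {M : CoxeterMatrix B} {cs : CoxeterSystem M W}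
  {𝕜 V : Type*} [CommRing 𝕜] [AddCommGroup V] [Module 𝕜 V] {𝔥 : Realization cs 𝕜 V}

theorem mul_mem_symDeg {N : Type*} [AddCommGroup N] [Module 𝕜 N] {k l : ℕ}
    {x y : SymmetricAlgebra 𝕜 N} (hx : x ∈ symDeg 𝕜 N k) (hy : y ∈ symDeg 𝕜 N l) :
    x * y ∈ symDeg 𝕜 N (k + l) := by
  rw [symDeg, pow_add]
  exact Submodule.mul_mem_mul hx hy

theorem one_mem_symDeg_zero {N : Type*} [AddCommGroup N] [Module 𝕜 N] :
    (1 : SymmetricAlgebra 𝕜 N) ∈ symDeg 𝕜 N 0 := by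
  rw [symDeg, pow_zero]
  exact Submodule.one_le.mp le_rfl

/-- Contraction lowers the exterior degree by one, and a natural number exponent has nothing below
`0`. This case is therefore separate from `contractLeft_mem`. -/
theorem contractLeft_of_mem_zero {N : Type*} [AddCommGroup N] [Module 𝕜 N] (d : Module.Dual 𝕜 N)
    {r : ExteriorAlgebra 𝕜 N} (hr : r ∈ ⋀[𝕜]^0 N) :
    CliffordAlgebra.contractLeft (Q := (0 : QuadraticForm 𝕜 N)) d r = 0 := by
  rw [ExteriorAlgebra.exteriorPower, pow_zero] at hr
  obtain ⟨c, rfl⟩ := Submodule.mem_one.mp hr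
  exact CliffordAlgebra.contractLeft_algebraMap _ d c

theorem contractLeft_mem {N : Type*} [AddCommGroup N] [Module 𝕜 N] (d : Module.Dual 𝕜 N) (k : ℕ)
    {r : ExteriorAlgebra 𝕜 N} (hr : r ∈ ⋀[𝕜]^(k + 1) N) :
    CliffordAlgebra.contractLeft (Q := (0 : QuadraticForm 𝕜 N)) d r ∈ ⋀[𝕜]^k N := by
  induction k generalizing r with
  | zero =>
    rw [zero_add, ExteriorAlgebra.exteriorPower, pow_one] at hr
    obtain ⟨v, rfl⟩ := hr
    rw [ExteriorAlgebra.exteriorPower, pow_zero]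
    exact Submodule.mem_one.mpr ⟨d v, (CliffordAlgebra.contractLeft_ι _ d v).symm⟩
  | succ k ih =>
    rw [ExteriorAlgebra.exteriorPower, pow_succ'] at hr
    induction hr using Submodule.mul_induction_on' with
    | mem_mul_mem a ha b hb =>
      obtain ⟨v, rfl⟩ := ha
      erw [CliffordAlgebra.contractLeft_ι_mul]
      -- In `d ⌢ (v b) = d(v) b - v (d ⌢ b)` the first term has the degree of `b`, and in the second
      -- the factor `v` restores the degree lost by contracting `b`.
      refine sub_mem (Submodule.smul_mem _ _ hb) ?_
      rw [ExteriorAlgebra.exteriorPower, pow_succ']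
      exact Submodule.mul_mem_mul ⟨v, rfl⟩ (ih hb)
    | add a _ b _ ha hb => rw [map_add]; exact add_mem ha hb

variable {E : LocalRel 𝔥} {F G H : DSeq B}

/-! ### Bidegrees of composites of diagrams and of matrices of diagrams -/

namespace DHom

theorem comp_mem_deg {u v w : List B} {g : DHom E v w} {f : DHom E u v} {m n : ℤ}
    (hg : g ∈ deg E v w m) (hf : f ∈ deg E u v n) : comp g f ∈ deg E u w (m + n) := by
  obtain ⟨d, hd, rfl⟩ := hg
  obtain ⟨e, he, rfl⟩ := hf
  exact ⟨_, .comp hd he, rfl⟩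

theorem id_mem_deg (v : List B) : id E v ∈ deg E v v 0 := ⟨_, .id v, rfl⟩

end DHom

namespace BEHom

theorem comp_mem_deg {g : BEHom E G H} {f : BEHom E F G} {i j i' j' : ℤ}
    (hg : g ∈ deg E G H i j) (hf : f ∈ deg E F G i' j') :
    comp g f ∈ deg E F H (i + i') (j + j') := by
  intro a c
  rw [comp_apply]
  refine ⟨fun h => sum_mem fun b _ => ?_, fun h => Finset.sum_eq_zero fun b _ => ?_⟩
  -- Position differences add up. If the component of `f` through `b` sits in the right position,
  -- then the component of `g` is in the right position exactly when the composite is. Otherwise the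
  -- component of `f` vanishes.
  · by_cases hb : G.pos b - F.pos a = i' - j'
    · rw [show H.shift c + (j + j') - F.shift a =
        H.shift c + j - G.shift b + (G.shift b + j' - F.shift a) by ring]
      exact DHom.comp_mem_deg ((hg b c).1 (by omega)) ((hf a b).1 hb)
    · rw [(hf a b).2 hb, map_zero]
      exact zero_mem _
  · by_cases hb : G.pos b - F.pos a = i' - j'
    · rw [(hg b c).2 (by omega), map_zero, LinearMap.zero_apply]
    · rw [(hf a b).2 hb, map_zero]

theorem id_mem_deg : id E F ∈ deg E F F 0 0 := by
  intro a b
  by_cases h : a = b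
  · subst h
    simpa [id] using DHom.id_mem_deg (E := E) (F.word a)
  · simp [id, h]

end BEHom

/-! ### Contraction and right multiplication on free-monodromic morphisms -/

namespace FMHom

theorem tmul_mem_deg {k l : ℕ} {a b i j : ℤ} (hi : k + a = i) (hj : 2 * k + b - 2 * l = j)
    {r : ExteriorAlgebra 𝕜 (Module.Dual 𝕜 V)} (hr : r ∈ ⋀[𝕜]^k (Module.Dual 𝕜 V))
    {f : BEHom E F G} (hf : f ∈ BEHom.deg E F G a b) {x : SymmetricAlgebra 𝕜 V}
    (hx : x ∈ symDeg 𝕜 V l) : r ⊗ₜ (f ⊗ₜ x) ∈ deg E F G i j :=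
  Submodule.subset_span ⟨k, l, a, b, hi, hj, r, hr, f, hf, x, hx, rfl⟩

theorem id_mem_deg : id E F ∈ deg E F F 0 0 :=
  tmul_mem_deg (k := 0) (l := 0) (by simp) (by simp)
    (by rw [ExteriorAlgebra.exteriorPower, pow_zero]; exact Submodule.one_le.mp le_rfl)
    BEHom.id_mem_deg one_mem_symDeg_zero

theorem comp_mem_deg {g : FMHom E G H} {f : FMHom E F G} {i j i' j' : ℤ}
    (hg : g ∈ deg E G H i j) (hf : f ∈ deg E F G i' j') :
    comp g f ∈ deg E F H (i + i') (j + j') := by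
  induction hg using Submodule.span_induction with
  | zero => rw [map_zero, LinearMap.zero_apply]; exact zero_mem _
  | add x y _ _ hx hy => rw [map_add, LinearMap.add_apply]; exact add_mem hx hy
  | smul c x _ hx => rw [map_smul, LinearMap.smul_apply]; exact Submodule.smul_mem _ c hx
  | mem x h =>
  obtain ⟨k, l, a, b, rfl, rfl, r, hr, g, hg, x, hx, rfl⟩ := h
  induction hf using Submodule.span_induction with
  | zero => rw [map_zero]; exact zero_mem _
  | add x y _ _ hx hy => rw [map_add]; exact add_mem hx hy
  | smul c x _ hx => rw [map_smul]; exact Submodule.smul_mem _ c hx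
  | mem x h =>
  obtain ⟨k', l', a', b', rfl, rfl, r', hr', f, hf, y, hy, rfl⟩ := h
  have h : (r * r') ⊗ₜ[𝕜] (BEHom.comp g f ⊗ₜ[𝕜] (x * y)) ∈
      deg E F H (k + a + (k' + a')) (2 * k + b - 2 * l + (2 * k' + b' - 2 * l')) := by
    refine tmul_mem_deg (k := k + k') (l := l + l') ?_ ?_ ?_ (BEHom.comp_mem_deg hg hf)
      (mul_mem_symDeg hx hy)
    · push_cast; ring
    · push_cast; ring
    · rw [ExteriorAlgebra.exteriorPower, pow_add]
      exact Submodule.mul_mem_mul hr hr'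
  -- Since `g` is homogeneous, only one of its parity parts survives, and the composite is `± (r r')
  -- ⊗ (g f) ⊗ (x y)` with sign `1` or `(-1)^k'`.
  rw [comp_tmul, BEHom.even_of_mem_deg hg, BEHom.odd_of_mem_deg hg, involute_of_mem hr']
  split_ifs
  · simpa using h
  · simpa [TensorProduct.smul_tmul'] using Submodule.smul_mem _ ((-1 : 𝕜) ^ k') h

theorem contract_tmul (x : V) (r : ExteriorAlgebra 𝕜 (Module.Dual 𝕜 V)) (f : BEHom E F G)
    (y : SymmetricAlgebra 𝕜 V) :
    contract x (r ⊗ₜ[𝕜] (f ⊗ₜ[𝕜] y)) =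
      CliffordAlgebra.contractLeft (Module.Dual.eval 𝕜 V x) r ⊗ₜ[𝕜] (f ⊗ₜ[𝕜] y) := rfl

theorem contract_mem_deg (x : V) {f : FMHom E F G} {i j : ℤ} (hf : f ∈ deg E F G i j) :
    contract x f ∈ deg E F G (i - 1) (j - 2) := by
  induction hf using Submodule.span_induction with
  | zero => rw [map_zero]; exact zero_mem _
  | add x y _ _ hx hy => rw [map_add]; exact add_mem hx hy
  | smul c x _ hx => rw [map_smul]; exact Submodule.smul_mem _ c hx
  | mem z h =>
  obtain ⟨k, l, a, b, rfl, rfl, r, hr, f, hf, y, hy, rfl⟩ := h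
  rw [contract_tmul]
  cases k with
  | zero =>
    -- Scalars of the exterior algebra contract to `0`, which lies in every bidegree.
    rw [contractLeft_of_mem_zero _ hr, TensorProduct.zero_tmul]
    exact zero_mem _
  | succ k =>
    refine tmul_mem_deg (k := k) ?_ ?_ (contractLeft_mem _ k hr) hf hy
    · push_cast; ring
    · push_cast; ring

/-- Contraction is an antiderivation of the exterior algebra, and passing it over `g` costs the
total sign `(-1)^{|g|}`. The involution of the exterior factor of `g` gives one part of this sign.
The odd matrix part of `g` gives the other, because the composition already twists the second
exterior factor there and contraction anticommutes with that twist. -/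
theorem contract_comp (x : V) (g : FMHom E G H) (f : FMHom E F G) :
    contract x (comp g f) = comp (contract x g) f + comp (sgn g) (contract x f) := by
  induction g using ind with
  | h0 => simp
  | ha a b ha hb => simp only [map_add, LinearMap.add_apply, ha, hb]; abel
  | ht r₁ f₁ x₁ =>
  induction f using ind with
  | h0 => simp
  | ha a b ha hb => simp only [map_add, ha, hb]; abel
  | ht r₂ f₂ x₂ =>
  simp only [comp_tmul, contract_tmul, sgn_tmul, map_add, contractLeft_mul, contractLeft_involute,
    map_sub, BEHom.even_even, BEHom.even_odd, BEHom.odd_even, BEHom.odd_odd, sub_zero, zero_sub,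
    map_neg, LinearMap.neg_apply, TensorProduct.neg_tmul, TensorProduct.tmul_neg,
    TensorProduct.add_tmul, mul_neg]
  abel

/-- Contraction is an odd operator: it changes the exterior degree by one and leaves the other
factors alone. -/
theorem contract_sgn (x : V) (f : FMHom E F G) : contract x (sgn f) = -sgn (contract x f) := by
  induction f using ind with
  | h0 => simp
  | ha a b ha hb => simp only [map_add, ha, hb]; abel
  | ht r f y =>
    simp only [sgn_tmul, contract_tmul, contractLeft_involute, TensorProduct.neg_tmul]

/-- Contraction as a linear function of the vector. -/
noncomputable def contractₗ (f : FMHom E F G) : V →ₗ[𝕜] FMHom E F G where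
  toFun x := contract x f
  map_add' x y := by
    induction f using ind with
    | h0 => simp
    | ha a b ha hb => simp only [map_add, ha, hb]; abel
    | ht r f z =>
      simp only [contract_tmul, map_add, LinearMap.add_apply, TensorProduct.add_tmul]
  map_smul' c x := by
    induction f using ind with
    | h0 => simp
    | ha a b ha hb => simp only [map_add, ha, hb, smul_add]
    | ht r f z =>
      simp only [contract_tmul, map_smul, LinearMap.smul_apply, TensorProduct.smul_tmul',
        RingHom.id_apply]

theorem rightMul_tmul (y : SymmetricAlgebra 𝕜 V) (r : ExteriorAlgebra 𝕜 (Module.Dual 𝕜 V))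
    (f : BEHom E F G) (x : SymmetricAlgebra 𝕜 V) :
    rightMul y (r ⊗ₜ[𝕜] (f ⊗ₜ[𝕜] x)) = r ⊗ₜ[𝕜] (f ⊗ₜ[𝕜] (x * y)) := rfl

theorem rightMul_mem_deg {y : SymmetricAlgebra 𝕜 V} {l : ℕ} (hy : y ∈ symDeg 𝕜 V l)
    {f : FMHom E F G} {i j : ℤ} (hf : f ∈ deg E F G i j) :
    rightMul y f ∈ deg E F G i (j - 2 * l) := by
  induction hf using Submodule.span_induction with
  | zero => rw [map_zero]; exact zero_mem _
  | add x y _ _ hx hy => rw [map_add]; exact add_mem hx hy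
  | smul c x _ hx => rw [map_smul]; exact Submodule.smul_mem _ c hx
  | mem z h =>
  obtain ⟨k, l', a, b, rfl, rfl, r, hr, f, hf, x, hx, rfl⟩ := h
  rw [rightMul_tmul]
  refine tmul_mem_deg rfl ?_ hr hf (mul_mem_symDeg hx hy)
  push_cast; ring

/-- The sign in the composition ignores the `R^∨` factors, so only associativity of `R^∨` is at
stake here. Its companion `comp_rightMul` also needs commutativity, to carry `y` past the factor of
`f`. -/
theorem rightMul_comp (y : SymmetricAlgebra 𝕜 V) (g : FMHom E G H) (f : FMHom E F G) :
    rightMul y (comp g f) = comp g (rightMul y f) := by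
  induction g using ind with
  | h0 => simp
  | ha a b ha hb => simp only [map_add, LinearMap.add_apply, ha, hb]
  | ht r₁ f₁ x₁ =>
  induction f using ind with
  | h0 => simp
  | ha a b ha hb => simp only [map_add, ha, hb]
  | ht r₂ f₂ x₂ => simp only [comp_tmul, rightMul_tmul, map_add, mul_assoc]

theorem comp_rightMul (y : SymmetricAlgebra 𝕜 V) (g : FMHom E G H) (f : FMHom E F G) :
    comp (rightMul y g) f = rightMul y (comp g f) := by
  induction g using ind with
  | h0 => simp
  | ha a b ha hb => simp only [map_add, LinearMap.add_apply, ha, hb]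
  | ht r₁ f₁ x₁ =>
  induction f using ind with
  | h0 => simp
  | ha a b ha hb => simp only [map_add, ha, hb]
  | ht r₂ f₂ x₂ => simp only [comp_tmul, rightMul_tmul, map_add, mul_right_comm]

theorem sgn_rightMul (y : SymmetricAlgebra 𝕜 V) (f : FMHom E F G) :
    sgn (rightMul y f) = rightMul y (sgn f) := by
  induction f using ind with
  | h0 => simp
  | ha a b ha hb => simp only [map_add, ha, hb]
  | ht r f x => simp only [rightMul_tmul, sgn_tmul]

theorem rightMul_one (f : FMHom E F G) : rightMul 1 f = f := by
  induction f using ind with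
  | h0 => simp
  | ha a b ha hb => simp only [map_add, ha, hb]
  | ht r f x => rw [rightMul_tmul, mul_one]

theorem rightMul_rightMul (y z : SymmetricAlgebra 𝕜 V) (f : FMHom E F G) :
    rightMul z (rightMul y f) = rightMul (y * z) f := by
  induction f using ind with
  | h0 => simp
  | ha a b ha hb => simp only [map_add, ha, hb]
  | ht r f x => simp only [rightMul_tmul, mul_assoc]

theorem rightMul_add (y z : SymmetricAlgebra 𝕜 V) (f : FMHom E F G) :
    rightMul (y + z) f = rightMul y f + rightMul z f := by
  induction f using ind with
  | h0 => simp
  | ha a b ha hb => simp only [map_add, ha, hb]; abel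
  | ht r f x => simp only [rightMul_tmul, mul_add, TensorProduct.tmul_add]

theorem rightMul_smul (c : 𝕜) (y : SymmetricAlgebra 𝕜 V) (f : FMHom E F G) :
    rightMul (c • y) f = c • rightMul y f := by
  induction f using ind with
  | h0 => simp
  | ha a b ha hb => simp only [map_add, ha, hb, smul_add]
  | ht r f x => simp only [rightMul_tmul, mul_smul_comm, TensorProduct.tmul_smul]

/-! ### Compatibility with the Koszul differential and with `Θ` -/

variable [Module.Free 𝕜 V] [Module.Finite 𝕜 V]

/-- `κ` is a sum of contractions, each paired with a box operator on the middle factor, and two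
contractions of the exterior algebra anticommute. -/
theorem contract_kappa (x : V) (f : FMHom E F G) :
    contract x (kappa f) = -kappa (contract x f) := by
  induction f using ind with
  | h0 => simp
  | ha a b ha hb => simp only [map_add, ha, hb]; abel
  | ht r f y =>
    simp only [contract_tmul, kappa_tmul, map_sum, ← Finset.sum_neg_distrib]
    refine Finset.sum_congr rfl fun i _ => ?_
    rw [CliffordAlgebra.contractLeft_comm, TensorProduct.neg_tmul]

theorem contract_Theta (x : V) : contract x (Theta E F) = 0 := by
  simp [Theta, contract_tmul]

theorem kappa_rightMul (y : SymmetricAlgebra 𝕜 V) (f : FMHom E F G) :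
    kappa (rightMul y f) = rightMul y (kappa f) := by
  induction f using ind with
  | h0 => simp
  | ha a b ha hb => simp only [map_add, ha, hb]
  | ht r f x => simp only [rightMul_tmul, kappa_tmul, map_sum]

end FMHom

end Monodromy

/-! ### Monodromy on cochains: the cocycle and the homotopy -/

section Monodromy

variable {B W : Type*} [Group W] {M : CoxeterMatrix B} {cs : CoxeterSystem M W}
  {𝕜 V : Type*} [CommRing 𝕜] [AddCommGroup V] [Module 𝕜 V] {𝔥 : Realization cs 𝕜 V}
  {E : LocalRel 𝔥} [Module.Free 𝕜 V] [Module.Finite 𝕜 V]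

namespace FMObj

theorem contract_δ_mem_deg (F : FMObj E) (x : V) :
    FMHom.contract x F.δ ∈ FMHom.deg E F.seq F.seq 0 (-2) := by
  simpa using FMHom.contract_mem_deg x F.δ_mem

/-- This is the contraction with `x` of the defining equation `δ ∘ δ + κ(δ) = Θ`, up to a global
sign. -/
theorem diff_contract_δ (F : FMObj E) (x : V) : diff F F (FMHom.contract x F.δ) = 0 := by
  have h := congrArg (FMHom.contract x) F.δ_comp_δ
  rw [map_add, FMHom.contract_comp, sgn_δ, FMHom.contract_kappa, FMHom.contract_Theta, map_neg,
    LinearMap.neg_apply] at h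
  -- Here `h` reads `(x ⌢ δ) ∘ δ - δ ∘ (x ⌢ δ) - κ(x ⌢ δ) = 0`. Because `x ⌢ δ` has cohomological
  -- degree `0`, its sign in `d` is `+1`, so the left side is `-d(x ⌢ δ)`.
  rw [diff_apply, FMHom.sgn_of_mem_deg (F.contract_δ_mem_deg x), if_pos Even.zero, ← neg_eq_zero,
    ← h]
  abel

/-- Contraction with `x` is a homotopy between the two compositions with `x ⌢ δ`. -/
theorem diff_contract {F G : FMObj E} (x : V) (f : FMHom E F.seq G.seq) :
    diff F G (FMHom.contract x f) + FMHom.contract x (diff F G f) =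
      FMHom.comp (FMHom.contract x G.δ) f - FMHom.comp f (FMHom.contract x F.δ) := by
  -- The `κ` terms cancel, as do the terms `δ_G ∘ (x ⌢ f)`, since `δ_G` is odd, and the terms in
  -- which `f` is contracted before composing with `δ_F`. What remains are the terms where the
  -- contraction hits `δ_G` or `δ_F`.
  simp only [diff_apply, map_add, map_sub, FMHom.contract_kappa, FMHom.contract_comp, sgn_δ,
    FMHom.contract_sgn, FMHom.sgn_sgn, map_neg, LinearMap.neg_apply]
  abel

theorem diff_rightMul (F G : FMObj E) (y : SymmetricAlgebra 𝕜 V) (f : FMHom E F.seq G.seq) :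
    diff F G (FMHom.rightMul y f) = FMHom.rightMul y (diff F G f) := by
  simp only [diff_apply, FMHom.kappa_rightMul, map_add, map_sub, FMHom.rightMul_comp,
    FMHom.sgn_rightMul, FMHom.comp_rightMul]

end FMObj

/-! ### Monodromy on cohomology -/

namespace gHom

variable {F G H : FMObj E}

theorem comp_mem_deg {g : gHom G H} {f : gHom F G} {i j i' j' : ℤ}
    (hg : g ∈ deg G H i j) (hf : f ∈ deg F G i' j') :
    comp g f ∈ deg F H (i + i') (j + j') := by
  obtain ⟨g, _, hg', rfl⟩ := Cohomology.exists_of_mem_classes hg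
  obtain ⟨f, _, hf', rfl⟩ := Cohomology.exists_of_mem_classes hf
  exact Cohomology.mk_mem_classes _ (FMHom.comp_mem_deg hg' hf')

theorem one_mem_deg (F : FMObj E) : (1 : gHom F F) ∈ deg F F 0 0 :=
  Cohomology.mk_mem_classes _ FMHom.id_mem_deg

/-- The class of `x ⌢ δ_F`, as a linear function of `x`. -/
noncomputable def contractClass (F : FMObj E) : V →ₗ[𝕜] gHom F F :=
  Cohomology.mkₗ (FMObj.diff F F) ∘ₗ
    (FMHom.contractₗ F.δ).codRestrict (LinearMap.ker (FMObj.diff F F)) F.diff_contract_δ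

theorem contractClass_apply (F : FMObj E) (x : V) :
    contractClass F x = mk (FMHom.contract x F.δ) (F.diff_contract_δ x) := rfl

/-- On a cocycle `f` the homotopy identity exhibits the difference of the two composites as the
coboundary of `x ⌢ f`. The case `F = G` is the centrality that `monodromy` relies on. -/
theorem contractClass_comp (x : V) (f : gHom F G) :
    comp (contractClass G x) f = comp f (contractClass F x) := by
  induction f using Cohomology.ind with | h f hf => ?_
  simp only [contractClass_apply]
  refine Cohomology.mk_eq_mk_iff.mpr ⟨FMHom.contract x f, ?_⟩
  rw [← FMObj.diff_contract, hf, map_zero, add_zero]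

/-- The algebra homomorphism from the symmetric algebra of `V` to `gEnd(F)` that extends
`x ↦ [x ⌢ δ_F]`. Its values are central. -/
noncomputable def monodromy (F : FMObj E) : SymmetricAlgebra 𝕜 V →ₐ[𝕜] gHom F F :=
  (Subalgebra.center 𝕜 (gHom F F)).val.comp
    -- The universal property of the symmetric algebra asks for a commutative target. The algebra
    -- `gEnd(F)` need not be one, but its center is, and it contains all the classes `[x ⌢ δ_F]`.
    (SymmetricAlgebra.lift ((contractClass F).codRestrict
      (Subalgebra.toSubmodule (Subalgebra.center 𝕜 (gHom F F)))
      fun x => (Subalgebra.mem_center_iff (R := 𝕜)).mpr fun f => (contractClass_comp x f).symm))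

theorem monodromy_ι (F : FMObj E) (x : V) :
    monodromy F (SymmetricAlgebra.ι 𝕜 V x) = contractClass F x := by
  rw [monodromy, AlgHom.comp_apply]
  erw [SymmetricAlgebra.lift_ι_apply]
  rfl

theorem monodromy_unique (F : FMObj E) (ν : SymmetricAlgebra 𝕜 V →ₐ[𝕜] gHom F F)
    (h : ∀ x, ν (SymmetricAlgebra.ι 𝕜 V x) = contractClass F x) : ν = monodromy F := by
  ext x
  exact (h x).trans (monodromy_ι F x).symm

/-- For fixed `f`, the elements `x` with this property form a subalgebra of `Sym(V)`, and
`contractClass_comp` says that it contains `V`. -/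
theorem monodromy_comp (x : SymmetricAlgebra 𝕜 V) (f : gHom F G) :
    comp (monodromy G x) f = comp f (monodromy F x) := by
  induction x using SymmetricAlgebra.induction with
  | algebraMap c =>
    rw [AlgHom.commutes, AlgHom.commutes, Algebra.algebraMap_eq_smul_one,
      Algebra.algebraMap_eq_smul_one, map_smul, map_smul, LinearMap.smul_apply, one_comp, comp_one]
  | ι x => rw [monodromy_ι, monodromy_ι, contractClass_comp]
  | mul a b ha hb =>
    rw [map_mul (monodromy G), map_mul (monodromy F), mul_def, mul_def, comp_assoc, hb]
    -- After `b` has passed to the right of `f`, reassociating brings `μ_G(a)` next to `f`; it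
    -- passes in turn and lands to the left of `μ_F(b)`, so the order of the product is kept.
    exact (comp_assoc _ _ _).symm.trans ((congrArg (comp · _) ha).trans (comp_assoc _ _ _))
  | add a b ha hb => rw [map_add, map_add, map_add, map_add, LinearMap.add_apply, ha, hb]

/-- An element of polynomial degree `l` is a combination of products of `l` vectors. Each vector
acts in bidegree `(0, -2)`, and bidegrees add under composition. -/
theorem monodromy_mem_deg (F : FMObj E) {l : ℕ} {x : SymmetricAlgebra 𝕜 V}
    (hx : x ∈ symDeg 𝕜 V l) : monodromy F x ∈ deg F F 0 (-2 * l) := by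
  induction hx using Submodule.pow_induction_on_left' with
  | algebraMap c =>
    rw [AlgHom.commutes, Algebra.algebraMap_eq_smul_one]
    simpa using Submodule.smul_mem _ c (one_mem_deg F)
  | add x y i hx hy h₁ h₂ => rw [map_add]; exact add_mem h₁ h₂
  | mem_mul m hm i x hx h =>
    obtain ⟨v, rfl⟩ := hm
    have hv : contractClass F v ∈ deg F F 0 (-2) :=
      Cohomology.mk_mem_classes _ (F.contract_δ_mem_deg v)
    rw [map_mul, mul_def, monodromy_ι]
    have := comp_mem_deg hv h
    rwa [show (0 : ℤ) + 0 = 0 by ring, show (-2 : ℤ) + -2 * i = -2 * (i + 1 : ℕ) by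
      push_cast; ring] at this

/-- Left monodromy. -/
noncomputable def leftMonodromy (F G : FMObj E) :
    SymmetricAlgebra 𝕜 V →ₐ[𝕜] Module.End 𝕜 (gHom F G) :=
  AlgHom.ofLinearMap (comp ∘ₗ (monodromy G).toLinearMap)
    (LinearMap.ext fun f => by simp [one_comp])
    (fun x y => LinearMap.ext fun f => by simp [mul_def, comp_assoc])

theorem leftMonodromy_apply (x : SymmetricAlgebra 𝕜 V) (f : gHom F G) :
    leftMonodromy F G x f = comp (monodromy G x) f := rfl

/-- The action of an element of `R^∨` on the right. -/
noncomputable def rightMul (y : SymmetricAlgebra 𝕜 V) : gHom F G →ₗ[𝕜] gHom F G :=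
  Cohomology.map (FMHom.rightMul y) (FMObj.diff_rightMul F G y)

theorem rightMul_mem_deg {y : SymmetricAlgebra 𝕜 V} {l : ℕ} (hy : y ∈ symDeg 𝕜 V l)
    {f : gHom F G} {i j : ℤ} (hf : f ∈ deg F G i j) : rightMul y f ∈ deg F G i (j - 2 * l) := by
  obtain ⟨f, _, hf', rfl⟩ := Cohomology.exists_of_mem_classes hf
  exact Cohomology.mk_mem_classes _ (FMHom.rightMul_mem_deg hy hf')

theorem rightMul_comp (y : SymmetricAlgebra 𝕜 V) (g : gHom G H) (f : gHom F G) :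
    rightMul y (comp g f) = comp g (rightMul y f) := by
  induction g using Cohomology.ind
  induction f using Cohomology.ind
  exact Cohomology.mk_congr (FMHom.rightMul_comp y _ _) _ _

theorem comp_rightMul (y : SymmetricAlgebra 𝕜 V) (g : gHom G H) (f : gHom F G) :
    comp (rightMul y g) f = rightMul y (comp g f) := by
  induction g using Cohomology.ind
  induction f using Cohomology.ind
  exact Cohomology.mk_congr (FMHom.comp_rightMul y _ _) _ _

/-- Right monodromy. -/
noncomputable def rightMonodromy (F G : FMObj E) :
    (SymmetricAlgebra 𝕜 V)ᵐᵒᵖ →ₐ[𝕜] Module.End 𝕜 (gHom F G) :=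
  AlgHom.ofLinearMap
    { toFun := fun y => rightMul y.unop
      map_add' := fun y z => LinearMap.ext fun f => by
        induction f using Cohomology.ind with | h f hf => ?_
        exact Cohomology.mk_congr (FMHom.rightMul_add y.unop z.unop f) _ _
      map_smul' := fun c y => LinearMap.ext fun f => by
        induction f using Cohomology.ind with | h f hf => ?_
        exact Cohomology.mk_congr (FMHom.rightMul_smul c y.unop f) _ _ }
    (LinearMap.ext fun f => by
      induction f using Cohomology.ind with | h f hf => ?_
      exact Cohomology.mk_congr (FMHom.rightMul_one f) _ _)
    -- In the endomorphism ring the product of the actions of `y` and `z` applies `z` first, which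
    -- multiplies by `z.unop` and then by `y.unop`. This is the order of the product in the opposite
    -- algebra.
    (fun y z => LinearMap.ext fun f => by
      induction f using Cohomology.ind with | h f hf => ?_
      exact Cohomology.mk_congr (FMHom.rightMul_rightMul z.unop y.unop f).symm _ _)

end gHom

end Monodromy

/-! ### The monodromy theorem -/

theorem mainTheorem4 {B W 𝕜 V : Type*} [Finite B] [Group W] {M : CoxeterMatrix B}
    (cs : CoxeterSystem M W) [CommRing 𝕜] [IsDomain 𝕜] [AddCommGroup V] [Module 𝕜 V]
    [Module.Free 𝕜 V] [Module.Finite 𝕜 V] (𝔥 : Realization cs 𝕜 V) (hbal : 𝔥.IsBalanced)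
    (hdem : 𝔥.DemazureSurjective) (Z : H3Data 𝔥) :
    ∃ (μ : ∀ F : FMObj (ewRel Z), SymmetricAlgebra 𝕜 V →ₐ[𝕜] gHom F F)
      (L : ∀ F G : FMObj (ewRel Z), SymmetricAlgebra 𝕜 V →ₐ[𝕜] Module.End 𝕜 (gHom F G))
      (R : ∀ F G : FMObj (ewRel Z), (SymmetricAlgebra 𝕜 V)ᵐᵒᵖ →ₐ[𝕜] Module.End 𝕜 (gHom F G)),
      -- `μ_F` is determined by `μ_F(x) = [x ⌢ δ_F]` for `x ∈ V`, and it is bigraded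
      (∀ F x, ∃ h : FMObj.diff F F (FMHom.contract x F.δ) = 0,
        μ F (SymmetricAlgebra.ι 𝕜 V x) = gHom.mk (FMHom.contract x F.δ) h) ∧
      (∀ (F : FMObj (ewRel Z)) (ν : SymmetricAlgebra 𝕜 V →ₐ[𝕜] gHom F F),
        (∀ x, ν (SymmetricAlgebra.ι 𝕜 V x) = μ F (SymmetricAlgebra.ι 𝕜 V x)) → ν = μ F) ∧
      (∀ F (l : ℕ), ∀ x ∈ symDeg 𝕜 V l, μ F x ∈ gHom.deg F F 0 (-2 * l)) ∧
      -- the left monodromy action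
      (∀ F G x (f : gHom F G), L F G x f = gHom.comp (μ G x) f) ∧
      (∀ F G x (f : gHom F G), L F G x f = gHom.comp f (μ F x)) ∧
      (∀ F G (l : ℕ) (i j : ℤ), ∀ x ∈ symDeg 𝕜 V l, ∀ f ∈ gHom.deg F G i j,
        L F G x f ∈ gHom.deg F G i (j - 2 * l)) ∧
      (∀ F G H x (g : gHom G H) (f : gHom F G),
        L F H x (gHom.comp g f) = gHom.comp (L G H x g) f ∧
        L F H x (gHom.comp g f) = gHom.comp g (L F G x f)) ∧
      -- the right monodromy action
      (∀ (F G : FMObj (ewRel Z)) y (f : FMHom (ewRel Z) F.seq G.seq),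
        FMObj.diff F G (FMHom.rightMul y f) = FMHom.rightMul y (FMObj.diff F G f)) ∧
      (∀ (F G : FMObj (ewRel Z)) y (f : FMHom (ewRel Z) F.seq G.seq)
        (hf : FMObj.diff F G f = 0) (hf' : FMObj.diff F G (FMHom.rightMul y f) = 0),
        R F G (MulOpposite.op y) (gHom.mk f hf) = gHom.mk (FMHom.rightMul y f) hf') ∧
      (∀ F G (l : ℕ) (i j : ℤ), ∀ y ∈ symDeg 𝕜 V l, ∀ f ∈ gHom.deg F G i j,
        R F G (MulOpposite.op y) f ∈ gHom.deg F G i (j - 2 * l)) ∧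
      (∀ F G H y (g : gHom G H) (f : gHom F G),
        R F H (MulOpposite.op y) (gHom.comp g f) =
          gHom.comp (R G H (MulOpposite.op y) g) f ∧
        R F H (MulOpposite.op y) (gHom.comp g f) =
          gHom.comp g (R F G (MulOpposite.op y) f)) ∧
      -- the two actions commute
      (∀ F G x y (f : gHom F G), R F G (MulOpposite.op y) (L F G x f) =
        L F G x (R F G (MulOpposite.op y) f)) := by
  refine ⟨gHom.monodromy, gHom.leftMonodromy, gHom.rightMonodromy,
    fun F x => ⟨F.diff_contract_δ x, gHom.monodromy_ι F x⟩,
    fun F ν h => gHom.monodromy_unique F ν fun x => (h x).trans (gHom.monodromy_ι F x),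
    fun F l x hx => gHom.monodromy_mem_deg F hx,
    fun F G x f => rfl,
    fun F G x f => gHom.monodromy_comp x f,
    fun F G l i j x hx f hf => ?_,
    fun F G H x g f => ⟨(gHom.comp_assoc _ _ _).symm, ?_⟩,
    FMObj.diff_rightMul,
    fun F G y f hf hf' => rfl,
    fun F G l i j y hy f hf => gHom.rightMul_mem_deg hy hf,
    fun F G H y g f => ⟨(gHom.comp_rightMul y g f).symm, gHom.rightMul_comp y g f⟩,
    -- The left action is composition with `μ_G(x)`, so commutation of the actions is the
    -- compatibility of right multiplication with composition.
    fun F G x y f => gHom.rightMul_comp y _ f⟩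
  · have := gHom.comp_mem_deg (gHom.monodromy_mem_deg G hx) hf
    rwa [zero_add, show -2 * (l : ℤ) + j = j - 2 * l by ring] at this
  -- Moving the action onto `f` requires carrying the monodromy past `g`: `μ_H(x) ∘ g` becomes `g ∘
  -- μ_G(x)`.
  · rw [gHom.leftMonodromy_apply, gHom.leftMonodromy_apply, ← gHom.comp_assoc,
      gHom.monodromy_comp, gHom.comp_assoc]
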